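/- Let $\mathbb F_q$ be a finite field of odd characteristic with $q$ elements, let $\mathbb F_{q^2}$ be its quadratic extension, and let $G=\mathrm{PGL}_2(\mathbb F_q)$. Let $H\subset G$ be the image of the group of invertible diagonal matrices. Fix a non-square $\alpha\in\mathbb F_q^\times$ and let $K\subset G$ be the image of the group of invertible matrices of the form $\begin{pmatrix} a&\alpha b\\ b&a\end{pmatrix}$ (a non-split torus). Let $h_0\in H$ and $k_0\in K$ be the elements of order $2$ represented by $$h_0=\begin{pmatrix}-1&0\\0&1\end{pmatrix},\qquad k_0=\begin{pmatrix}0&\alpha\\1&0\end{pmatrix}.$$ All representations are complex. * For a character $\chi$ of $\mathbb F_q^\times$ with $\chi^2\ne1$, $\mathrm{Ps}(\chi,\chi^{-1})$ is the space of functions $f:G\to\mathbb C$ with $f\left(\begin{pmatrix}a&b\\0&1\end{pmatrix}g\right)=\chi(a)f(g)$, on which $G$ acts by right translation. * $\mathrm{St}$ is the space of complex functions on $\mathbb P^1(\mathbb F_q)$ with sum $0$. For $\chi^2=1$, $\mathrm{St}\otimes\chi$ is its twist by $\chi\circ\det$. * For a character $\psi$ of $\mathbb F_{q^2}^\times$ with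 $\psi\neq\psi^q=\psi^{-1}$, $\pi(\psi)$ is the cuspidal representation attached to $\psi$, that is, the representation with $\pi(\psi)\oplus \mathrm{Ind}_{\mathbb F_{q^2}^\times}^{G}\psi\cong\mathrm{Ind}_N^G\theta$. Here $N$ is the group of upper triangular unipotent matrices, $\theta$ is a non-trivial additive character of $\mathbb F_q\cong N$, $\mathbb F_{q^2}^\times$ maps to $G$ by its multiplication action on $\mathbb F_{q^2}\cong\mathbb F_q^2$, and $\mathrm{Ind}$ along this map consists of the functions $f:G\to\mathbb C$ with $f(xg)=\psi(x)f(g)$. Let $\pi$ be an irreducible representation of $G$, and write $\pi^H$ and $\pi^K$ for its spaces of $H$- and $K$-invariant vectors. 1. If $\dim\pi^H=\dim\pi^K=1$, then the sign by which $k_0$ acts on $\pi^H$ and the sign by which $h_0$ acts on $\pi^K$ coincide: there is $\varepsilon_\pi\in\{1,-1\}$ such that $\pi(k_0)v_H=\varepsilon_\pi v_H$ for all $v_H\in\pi^H$ and $\pi(h_0)v_K=\varepsilon_\pi v_K$ for all $v_K\in\pi^K$. 2. If $\pi$ is isomorphic to $\mathrm{Ps}(\chi,\chi^{-1})$ with $\chi^2\neq1$,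 to $\mathrm{St}\otimes\chi$ with $\chi^2=1$ and $\chi\ne1$, or to $\pi(\psi)$ with $\psi\neq\psi^q=\psi^{-1}$, then $\dim\pi^H=\dim\pi^K=1$, and the common sign is $$\varepsilon_\pi=\begin{cases}\chi(-1)&\text{if }\pi\cong\mathrm{Ps}(\chi,\chi^{-1})\text{ or }\pi\cong\mathrm{St}\otimes\chi,\\-\psi(\sqrt\delta)&\text{if }\pi\cong\pi(\psi),\end{cases}$$ where $\delta$ is any non-square in $\mathbb F_q^\times$ and $\sqrt\delta\in\mathbb F_{q^2}^\times$ is any square root of it. -/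

import Mathlib

open scoped MatrixGroups LinearAlgebra.Projectivization

noncomputable section

namespace PGL2Sign

variable {F : Type*} [Field F]

/-! ### Elements and tori of `PGL₂(F)` -/

/-- The class of `(a b; 0 1)` in `PGL₂(F)`, for `a ≠ 0`. -/
def borelElt (a : Fˣ) (b : F) : PGL(2, F) :=
  Matrix.ProjGenLinGroup.mk
    (Matrix.GeneralLinearGroup.mkOfDetNeZero !![(a : F), b; 0, 1] (by simp))

/-- The element `h₀`, the class of `diag(-1, 1)`. -/
def h₀ : PGL(2, F) :=
  Matrix.ProjGenLinGroup.mk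
    (Matrix.GeneralLinearGroup.mkOfDetNeZero !![(-1 : F), 0; 0, 1] (by simp))

/-- The element `k₀`, the class of `(0 α; 1 0)`. -/
def k₀ (α : Fˣ) : PGL(2, F) :=
  Matrix.ProjGenLinGroup.mk
    (Matrix.GeneralLinearGroup.mkOfDetNeZero !![(0 : F), (α : F); 1, 0] (by simp))

/-- The split torus `H` of `PGL₂(F)`: the image of the group of invertible diagonal matrices. -/
def splitTorus (F : Type*) [Field F] : Subgroup PGL(2, F) :=
  (Units.map (Matrix.diagonalRingHom (Fin 2) F : (Fin 2 → F) →* Matrix (Fin 2) (Fin 2) F)).range.map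
    Matrix.ProjGenLinGroup.mk

/-- The invertible matrices of the form `(a αb; b a)`. When `α` is a non-square this is a non-split
torus of `GL₂(F)`: it is the matrix form of `F(√α)ˣ` in the basis `1, √α`. -/
def nonsplitTorusGL (α : Fˣ) : Subgroup (GL (Fin 2) F) where
  carrier := {g | ∃ a b : F, (g : Matrix (Fin 2) (Fin 2) F) = !![a, α * b; b, a]}
  one_mem' := ⟨1, 0, by ext i j; fin_cases i <;> fin_cases j <;> simp⟩
  mul_mem' := by
    rintro g h ⟨a, b, hg⟩ ⟨c, d, hh⟩
    refine ⟨a * c + α * b * d, b * c + a * d, ?_⟩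
    rw [Units.val_mul, hg, hh]
    ext i j
    fin_cases i <;> fin_cases j <;> simp [Matrix.mul_apply, Fin.sum_univ_two] <;> ring
  inv_mem' := by
    rintro g ⟨a, b, hg⟩
    refine ⟨(g : Matrix (Fin 2) (Fin 2) F).det⁻¹ * a,
      -((g : Matrix (Fin 2) (Fin 2) F).det⁻¹ * b), ?_⟩
    rw [Matrix.coe_units_inv, Matrix.inv_def, Ring.inverse_eq_inv', hg, Matrix.adjugate_fin_two_of]
    ext i j
    fin_cases i <;> fin_cases j <;> simp <;> ring

/-- The non-split torus `K` of `PGL₂(F)` attached to a non-square `α`. -/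
def nonsplitTorus (α : Fˣ) : Subgroup PGL(2, F) :=
  (nonsplitTorusGL α).map Matrix.ProjGenLinGroup.mk

/-! ### Invariant vectors and signs -/

section Invariants

variable {G V : Type*} [Group G] [AddCommGroup V] [Module ℂ V]

/-- The space `π^S` of vectors fixed by the subgroup `S`. -/
def fixedSpace (π : Representation ℂ G V) (S : Subgroup G) : Submodule ℂ V :=
  Representation.invariants (π.comp S.subtype)

end Invariants

variable {V : Type*} [AddCommGroup V] [Module ℂ V]

/-- The spaces of `H`-invariant and of `K`-invariant vectors are both one dimensional. -/
def MultiplicityOne (α : Fˣ) (π : Representation ℂ PGL(2, F) V) : Prop :=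
  Module.finrank ℂ (fixedSpace π (splitTorus F)) = 1 ∧
    Module.finrank ℂ (fixedSpace π (nonsplitTorus α)) = 1

/-- `k₀` acts on the `H`-invariant vectors by the scalar `ε`, and `h₀` acts on the `K`-invariant
vectors by the same scalar `ε`. -/
def HasCommonSign (α : Fˣ) (π : Representation ℂ PGL(2, F) V) (ε : ℂ) : Prop :=
  (∀ v ∈ fixedSpace π (splitTorus F), π (k₀ α) v = ε • v) ∧
    ∀ v ∈ fixedSpace π (nonsplitTorus α), π h₀ v = ε • v

/-! ### The representations `Ps(χ, χ⁻¹)`, `St ⊗ χ` and `π(ψ)` -/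

/-- A character, as a representation on `ℂ`. -/
def charRep {G : Type*} [Monoid G] (c : G →* ℂˣ) : Representation ℂ G ℂ where
  toFun g := (c g : ℂ) • LinearMap.id
  map_one' := by ext; simp
  map_mul' g h := by ext; simp [mul_comm]

/-- The space of `Ps(χ, χ⁻¹)`: the functions `f` on `PGL₂(F)` with
`f ((a b; 0 1) g) = χ(a) f(g)`. -/
def principalSeriesSpace (χ : Fˣ →* ℂˣ) : Submodule ℂ (PGL(2, F) → ℂ) where
  carrier := {f | ∀ (a : Fˣ) (b : F) (g : PGL(2, F)), f (borelElt a b * g) = (χ a : ℂ) * f g}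
  add_mem' hf hg a b x := by simp [hf a b x, hg a b x, mul_add]
  zero_mem' a b x := by simp
  smul_mem' c f hf a b x := by simp [hf a b x, mul_left_comm]

/-- The principal series `Ps(χ, χ⁻¹)`: right translation on `principalSeriesSpace χ`. -/
def principalSeries (χ : Fˣ →* ℂˣ) :
    Representation ℂ PGL(2, F) (principalSeriesSpace χ) where
  toFun g := (LinearMap.funLeft ℂ ℂ (· * g)).restrict fun f hf a b x => by
    simpa [LinearMap.funLeft_apply, mul_assoc] using hf a b (x * g)
  map_one' := by ext; simp [LinearMap.funLeft_apply]
  map_mul' g h := by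
    refine LinearMap.ext fun f => Subtype.ext (funext fun x => ?_)
    change f.1 (x * (g * h)) = f.1 (x * g * h)
    rw [mul_assoc]

section Finite

variable [Finite F]

/-- The space of the Steinberg representation: complex functions on the (finite) projective line
over `F` whose values add up to `0`. -/
def steinbergSpace (F : Type*) [Field F] [Finite F] :
    Submodule ℂ (ℙ F (Fin 2 → F) → ℂ) where
  carrier := {f | ∑ᶠ x, f x = 0}
  add_mem' {f g} hf hg := by
    have := finsum_add_distrib (Set.toFinite (Function.support f))
      (Set.toFinite (Function.support g))
    simp_all
  zero_mem' := by simp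
  smul_mem' c f hf := by
    have := smul_finsum' c (Set.toFinite (Function.support f))
    simp_all

/-- The Steinberg representation `St`, `(g • f)(x) = f (g⁻¹ • x)` on `steinbergSpace F`. -/
def steinberg (F : Type*) [Field F] [Finite F] :
    Representation ℂ PGL(2, F) (steinbergSpace F) where
  toFun g := (LinearMap.funLeft ℂ ℂ (g⁻¹ • ·)).restrict fun f hf => by
    change ∑ᶠ x, f (g⁻¹ • x) = 0
    rw [← (show ∑ᶠ x, f x = 0 from hf)]
    exact finsum_comp_equiv (MulAction.toPerm g⁻¹)
  map_one' := by ext; simp [LinearMap.funLeft_apply]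
  map_mul' g h := by ext; simp [LinearMap.funLeft_apply, mul_smul]

end Finite

/-- For a character `χ` of `Fˣ` with `χ² = 1`, the character `χ ∘ det` of `PGL₂(F)`. -/
def detChar (χ : Fˣ →* ℂˣ) (hχ : χ ^ 2 = 1) : PGL(2, F) →* ℂˣ :=
  Matrix.ProjGenLinGroup.lift (χ.comp Matrix.GeneralLinearGroup.det) <| by
    ext u
    have h : Matrix.GeneralLinearGroup.det (Matrix.GeneralLinearGroup.scalar (Fin 2) u) = u ^ 2 := by
      ext; simp
    have h2 : (χ u) ^ 2 = 1 := by simpa using congrArg (fun c : Fˣ →* ℂˣ => c u) hχ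
    simp [h, h2]

/-- The twisted Steinberg representation `St ⊗ χ`, where `χ² = 1`. -/
def twistedSteinberg [Finite F] (χ : Fˣ →* ℂˣ) (hχ : χ ^ 2 = 1) :
    Representation ℂ PGL(2, F) (TensorProduct ℂ (steinbergSpace F) ℂ) :=
  (steinberg F).tprod (charRep (detChar χ hχ))

/-- The map `Eˣ → PGL₂(F)` given by the regular representation of a quadratic extension `E` of `F`
in the `F`-basis `b` of `E`. -/
def regularEmbedding {E : Type*} [Field E] [Algebra F E] (b : Module.Basis (Fin 2) F E) :
    Eˣ →* PGL(2, F) :=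
  Matrix.ProjGenLinGroup.mk.comp
    (Units.map (Algebra.leftMulMatrix b : E →* Matrix (Fin 2) (Fin 2) F))

/-- The unipotent subgroup `x ↦ (1 x; 0 1)` of `PGL₂(F)`. -/
def unipotent (F : Type*) [Field F] : Multiplicative F →* PGL(2, F) :=
  Matrix.ProjGenLinGroup.mk.comp Matrix.GeneralLinearGroup.upperRightHom.toMonoidHom

/-- `π` is the cuspidal representation `π(ψ)` attached to a character `ψ` of `Eˣ` (trivial on `Fˣ`
and not fixed by Frobenius), where `E` is the quadratic extension of `F`. By the standard
definition, `π(ψ)` is the representation whose class in the representation ring is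
`Ind_N θ - Ind_{Eˣ} ψ`, where `N` is the unipotent subgroup, `θ` a non-trivial additive character
of `F`, and `Eˣ` acts on `E ≅ F²` by multiplication; that is,
`π(ψ) ⊕ Ind_{Eˣ} ψ ≅ Ind_N θ`. (The isomorphism classes of both induced representations do not
depend on the choices of the basis `b` and of `θ`.) Here `Ind` is realised on functions with
`f (φ a * g) = ψ a • f g`, on which the group acts by right translation. -/
def IsCuspidalOf {E : Type*} [Field E] [Algebra F E] (π : Representation ℂ PGL(2, F) V)
    (ψ : Eˣ →* ℂˣ) : Prop :=
  ∃ (b : Module.Basis (Fin 2) F E) (θ : AddChar F ℂˣ), θ ≠ 1 ∧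
    Nonempty ((π.prod (Representation.coind (regularEmbedding b) (charRep ψ))).Equiv
      (Representation.coind (unipotent F) (charRep θ.toMonoidHom)))

end PGL2Sign

end

noncomputable section

namespace PGL2Sign

/-! ### Averages of characters and traces of induced representations -/

section Abstract

open scoped Classical

variable {G V : Type*} [Group G] [AddCommGroup V] [Module ℂ V]

/-! If an element `n` normalizes a finite subgroup `T` and `π^T` is a line, then `n` acts on it by
the average of the character of `π` over the coset `nT`, because the average over `T` projects onto
that line (`apply_eq_average_smul`). Both signs are thus coset averages. The cosets `k₀H` and `h₀K`
consist of classes of trace-zero matrices, and such a class is conjugate to `h₀` or to `k₀`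
according to whether `-det` is a square or not (`isConj_h₀`, `isConj_k₀`). On `k₀H` the value of
`-det` is `αt` with `t` ranging over `Fˣ`; on `h₀K` it is `N(e)` with `e` ranging over `Eˣ`, and the
norm is onto. Each class therefore fills half of each coset, and both signs equal half the sum of
the character values at `h₀` and `k₀` (`hasCommonSign_of_multiplicityOne`).

The explicit cases follow from character values. In each family the restriction to `H`, and likewise
to `K`, is the regular character plus a combination of nontrivial characters, so the trivial
character occurs once (`multiplicityOne_and_hasCommonSign`). The values come from a trace formula
for spaces of functions on the group (`character_of_projector`), from fixed points on the projective
line, and, for cuspidal `π`, from subtracting two induced characters. -/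

theorem finiteDimensional_of_isIrreducible [Finite G] (π : Representation ℂ G V)
    (hπ : π.IsIrreducible) : FiniteDimensional ℂ V := by
  obtain ⟨v, hv⟩ : ∃ v : V, v ≠ 0 := by
    by_contra! h
    have : Subsingleton V := ⟨fun a b => by rw [h a, h b]⟩
    have hs : (⊥ : Subrepresentation π) = ⊤ := by
      apply Subrepresentation.toSubmodule_injective
      exact Subsingleton.elim _ _
    exact bot_ne_top hs
  -- The orbit of `v` is finite and its span is invariant, hence everything.
  let W : Subrepresentation π :=
    { toSubmodule := Submodule.span ℂ (Set.range fun g => π g v)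
      apply_mem_toSubmodule := fun g w hw => by
        induction hw using Submodule.span_induction with
        | mem x hx =>
          obtain ⟨k, rfl⟩ := hx
          exact Submodule.subset_span ⟨g * k, by simp⟩
        | zero => simp
        | add x y _ _ hx hy => rw [map_add]; exact add_mem hx hy
        | smul c x _ hx => rw [map_smul]; exact Submodule.smul_mem _ _ hx }
  have hvW : v ∈ W.toSubmodule := Submodule.subset_span ⟨1, by simp⟩
  rcases eq_bot_or_eq_top W with h | h
  · rw [h] at hvW
    exact absurd hvW hv
  · have h' : Submodule.span ℂ (Set.range fun g => π g v) = ⊤ :=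
      congrArg Subrepresentation.toSubmodule h
    exact ⟨(Submodule.fg_iff_exists_finite_generating_family.2
      ⟨G, inferInstance, fun g => π g v, h'⟩)⟩

variable {A : Type*} [Group A]

theorem fixedSpace_range (φ : A →* G) (π : Representation ℂ G V) :
    fixedSpace π φ.range = Representation.invariants (π.comp φ) := by
  ext v
  simp [fixedSpace]

variable [Fintype A]

/-- The dimension of the space of vectors fixed by the image of `φ` is the average of the
character along `φ`. -/
theorem finrank_fixedSpace_range [FiniteDimensional ℂ V] (φ : A →* G)
    (π : Representation ℂ G V) :
    (Module.finrank ℂ (fixedSpace π φ.range) : ℂ) =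
      (Fintype.card A : ℂ)⁻¹ * ∑ a, π.character (φ a) := by
  have : Invertible (Nat.card A : ℂ) := invertibleOfNonzero (by simp)
  have := Representation.card_inv_mul_sum_char_eq_finrank (π.comp φ)
  rw [fixedSpace_range, ← this, Nat.card_eq_fintype_card]
  rfl

/-- An element normalizing the image of `φ` acts on a line of fixed vectors by the average of the
character over its coset. -/
theorem apply_eq_average_smul [FiniteDimensional ℂ V] (φ : A →* G) (π : Representation ℂ G V)
    (n : G) (hn : ∀ a, ∃ a', φ a * n = n * φ a')
    (h1 : Module.finrank ℂ (fixedSpace π φ.range) = 1)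
    {v : V} (hv : v ∈ fixedSpace π φ.range) :
    π n v = ((Fintype.card A : ℂ)⁻¹ * ∑ a, π.character (n * φ a)) • v := by
  have : Invertible (Fintype.card A : ℂ) := invertibleOfNonzero (by simp)
  rw [fixedSpace_range] at h1 hv
  set P := Representation.averageMap (π.comp φ) with hP
  have hproj := Representation.isProj_averageMap (π.comp φ)
  have hmem : ∀ w ∈ Representation.invariants (π.comp φ), π n w ∈ Representation.invariants (π.comp φ) := by
    intro w hw a
    obtain ⟨a', ha'⟩ := hn a
    have := hw a'
    simp only [MonoidHom.comp_apply] at this ⊢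
    rw [← Module.End.mul_apply, ← map_mul, ha', map_mul, Module.End.mul_apply, this]
  obtain ⟨w₀, hw₀, hspan⟩ := finrank_eq_one_iff'.1 h1
  obtain ⟨c, hc⟩ := hspan ⟨π n w₀, hmem _ w₀.2⟩
  have hcv : ∀ w ∈ Representation.invariants (π.comp φ), π n w = c • w := by
    intro w hw
    obtain ⟨d, hd⟩ := hspan ⟨w, hw⟩
    have hd' : d • (w₀ : V) = w := congrArg Subtype.val hd
    have hc' : c • (w₀ : V) = π n w₀ := congrArg Subtype.val hc
    rw [← hd', map_smul, ← hc', smul_comm]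
  -- `P` projects onto a line on which `n` acts by `c`, so this trace is `c`; expanding `P` as an
  -- average turns it into a character sum.
  have htr : LinearMap.trace ℂ V (π n ∘ₗ P) = c := by
    have : π n ∘ₗ P = c • P := by
      ext w
      exact hcv _ (hproj.map_mem w)
    rw [this, map_smul, hproj.trace, h1]
    simp
  have hsum : π n ∘ₗ P = (Fintype.card A : ℂ)⁻¹ • ∑ a, π (n * φ a) := by
    ext w
    simp [hP, GroupAlgebra.average, map_sum, LinearMap.sum_apply]
  rw [hcv v hv, ← htr, hsum]
  simp [Representation.character, map_sum]

/-- The character of the right translation representation on a space `W` of functions on `G` that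
is the image of the averaging projector `f ↦ ∑ₐ c a • f ((φ a)⁻¹ * ·)`. -/
theorem character_of_projector [Fintype G] {ι : Type*} [Fintype ι] {W : Submodule ℂ (G → ℂ)}
    (ρ : Representation ℂ G W) (hρ : ∀ g (f : W) x, (ρ g f : G → ℂ) x = (f : G → ℂ) (x * g))
    (φ : ι → G) (c : ι → ℂ)
    (hmem : ∀ f : G → ℂ, (fun x => ∑ a, c a * f ((φ a)⁻¹ * x)) ∈ W)
    (hid : ∀ f ∈ W, ∀ x, ∑ a, c a * f ((φ a)⁻¹ * x) = f x) (g : G) :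
    ρ.character g = ∑ x, ∑ a, if φ a = x * g * x⁻¹ then c a else 0 := by
  let P : (G → ℂ) →ₗ[ℂ] W :=
    { toFun := fun f => ⟨_, hmem f⟩
      map_add' := fun f g => Subtype.ext <| funext fun x => by
        simp [mul_add, Finset.sum_add_distrib]
      map_smul' := fun r f => Subtype.ext <| funext fun x => by
        simp [Finset.mul_sum, mul_left_comm] }
  have hP : P ∘ₗ W.subtype = LinearMap.id := by
    ext f x
    exact hid f f.2 x
  -- `P` retracts the whole function space onto `W`, so cyclicity moves the trace to that space,
  -- where point masses form a basis.
  have h1 : ρ g = (ρ g ∘ₗ P) ∘ₗ W.subtype := by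
    rw [LinearMap.comp_assoc, hP, LinearMap.comp_id]
  rw [Representation.character, h1, LinearMap.trace_comp_comm', LinearMap.trace_eq_matrix_trace ℂ
    (Pi.basisFun ℂ G), Matrix.trace]
  refine Finset.sum_congr rfl fun x _ => ?_
  rw [Matrix.diag_apply, LinearMap.toMatrix_apply]
  simp only [Pi.basisFun_apply, LinearMap.comp_apply, Submodule.subtype_apply, Pi.basisFun_repr, hρ]
  change ∑ a, c a * _ = _
  refine Finset.sum_congr rfl fun a _ => ?_
  rw [Pi.single_apply, mul_ite, mul_one, mul_zero]
  refine if_congr ?_ rfl rfl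
  rw [inv_mul_eq_iff_eq_mul, eq_mul_inv_iff_mul_eq, eq_comm]

/-- The character of the representation induced from a character `ψ` along `φ`. -/
theorem character_coind [Fintype G] (φ : A →* G) (ψ : A →* ℂˣ) (g : G) :
    (Representation.coind φ (charRep ψ)).character g =
      (Fintype.card A : ℂ)⁻¹ * ∑ x, ∑ a, if φ a = x * g * x⁻¹ then (ψ a : ℂ) else 0 := by
  rw [character_of_projector (Representation.coind φ (charRep ψ)) (fun _ _ _ => rfl) φ
    (fun a => (Fintype.card A : ℂ)⁻¹ * ψ a)]
  · simp only [Finset.mul_sum, mul_ite, mul_zero]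
  · intro f b x
    simp only [charRep, MonoidHom.coe_mk, OneHom.coe_mk, LinearMap.smul_apply, LinearMap.id_apply,
      smul_eq_mul, Finset.mul_sum]
    refine (Fintype.sum_equiv (Equiv.mulLeft b) _ _ fun a => ?_).symm
    simp [mul_assoc, mul_left_comm]
  · intro f hf x
    have : ∀ a, (ψ a : ℂ) * f ((φ a)⁻¹ * x) = f x := fun a => by
      have := hf a ((φ a)⁻¹ * x)
      simp only [mul_inv_cancel_left] at this
      rw [this]
      rfl
    simp [mul_assoc, this]

theorem character_prod {W : Type*} [AddCommGroup W] [Module ℂ W] [FiniteDimensional ℂ V]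
    [FiniteDimensional ℂ W] (π : Representation ℂ G V) (ρ : Representation ℂ G W) (g : G) :
    (π.prod ρ).character g = π.character g + ρ.character g :=
  LinearMap.trace_prodMap' _ _

theorem character_charRep (c : G →* ℂˣ) (g : G) : (charRep c).character g = c g := by
  simp [Representation.character, charRep]

end Abstract

/-! ### Elements of `PGL₂(F)` and the two classes of trace-zero matrices -/

section Elements

variable {F : Type*} [Field F]

theorem mk_eq_mk_of_eq_smul {g g' : GL (Fin 2) F} {u : F} (hu : u ≠ 0)
    (h : (g : Matrix (Fin 2) (Fin 2) F) = u • (g' : Matrix (Fin 2) (Fin 2) F)) :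
    Matrix.ProjGenLinGroup.mk g = Matrix.ProjGenLinGroup.mk g' := by
  symm
  refine Matrix.ProjGenLinGroup.mk_eq_mk_iff.2 ⟨Units.mk0 u hu, Units.ext ?_⟩
  rw [h]
  ext i j
  simp [mul_comm]

theorem exists_eq_smul_of_mk_eq_mk {g g' : GL (Fin 2) F}
    (h : Matrix.ProjGenLinGroup.mk g = Matrix.ProjGenLinGroup.mk g') :
    ∃ u : F, u ≠ 0 ∧ (g : Matrix (Fin 2) (Fin 2) F) = u • (g' : Matrix (Fin 2) (Fin 2) F) := by
  obtain ⟨u, hu⟩ := Matrix.ProjGenLinGroup.mk_eq_mk_iff.1 h.symm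
  refine ⟨u, u.ne_zero, ?_⟩
  rw [← hu]
  ext i j
  simp [mul_comm]

theorem isConj_mk_of_mul_eq_smul {X Y P : GL (Fin 2) F} {u : F} (hu : u ≠ 0)
    (h : (X : Matrix (Fin 2) (Fin 2) F) * P = u • ((P : Matrix (Fin 2) (Fin 2) F) * Y)) :
    IsConj (Matrix.ProjGenLinGroup.mk Y) (Matrix.ProjGenLinGroup.mk X) := by
  refine isConj_iff.2 ⟨Matrix.ProjGenLinGroup.mk P, ?_⟩
  rw [mul_inv_eq_iff_eq_mul, ← map_mul, ← map_mul]
  exact (mk_eq_mk_of_eq_smul hu h).symm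

/-- `X² = e²`, and the columns `(a - e, c)` and `(a + e, c)` of `P` are eigenvectors for `-e` and
`e`. They are independent because `2ec ≠ 0`. -/
theorem isConj_h₀ (h2 : (2 : F) ≠ 0) {X : GL (Fin 2) F} {a b c e : F}
    (hX : (X : Matrix (Fin 2) (Fin 2) F) = !![a, b; c, -a]) (hc : c ≠ 0) (he : e ≠ 0)
    (h : a ^ 2 + b * c = e ^ 2) : IsConj h₀ (Matrix.ProjGenLinGroup.mk X) := by
  refine isConj_mk_of_mul_eq_smul (P := .mkOfDetNeZero !![a - e, a + e; c, c] ?_) he ?_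
  · rw [Matrix.det_fin_two_of]
    have : (a - e) * c - (a + e) * c = -(2 * e * c) := by ring
    rw [this]
    simp [*]
  · rw [hX]
    change _ * !![_, _; _, _] = e • (!![_, _; _, _] * !![_, _; _, _])
    ext i j
    fin_cases i <;> fin_cases j <;> simp [Matrix.mul_apply, Fin.sum_univ_two] <;>
      first | ring1 | linear_combination h

/-- `X² = αe²`. The columns of `P` are `(e, 0)` and its image under `e⁻¹X`; in this cyclic basis `X`
becomes `e` times the matrix of `k₀`. -/
theorem isConj_k₀ {α : Fˣ} {X : GL (Fin 2) F} {a b c e : F}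
    (hX : (X : Matrix (Fin 2) (Fin 2) F) = !![a, b; c, -a]) (hc : c ≠ 0) (he : e ≠ 0)
    (h : a ^ 2 + b * c = α * e ^ 2) : IsConj (k₀ α) (Matrix.ProjGenLinGroup.mk X) := by
  refine isConj_mk_of_mul_eq_smul (P := .mkOfDetNeZero !![e, a; 0, c] ?_) he ?_
  · rw [Matrix.det_fin_two_of]
    simp [*]
  · rw [hX]
    change _ * !![_, _; _, _] = e • (!![_, _; _, _] * !![_, _; _, _])
    ext i j
    fin_cases i <;> fin_cases j <;> simp [Matrix.mul_apply, Fin.sum_univ_two] <;>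
      first | ring1 | linear_combination h

theorem borelElt_mul (a a' : Fˣ) (b b' : F) :
    borelElt a b * borelElt a' b' = borelElt (a * a') (a * b' + b) := by
  rw [borelElt, borelElt, ← map_mul]
  refine mk_eq_mk_of_eq_smul one_ne_zero ?_
  change !![_, _; _, _] * !![_, _; _, _] = (1 : F) • !![_, _; _, _]
  ext i j
  fin_cases i <;> fin_cases j <;> simp [Matrix.mul_apply, Fin.sum_univ_two]

theorem borelElt_one_zero : borelElt (1 : Fˣ) 0 = 1 := by
  rw [borelElt, ← map_one Matrix.ProjGenLinGroup.mk]
  refine mk_eq_mk_of_eq_smul one_ne_zero ?_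
  change !![_, _; _, _] = (1 : F) • (1 : Matrix (Fin 2) (Fin 2) F)
  ext i j
  fin_cases i <;> fin_cases j <;> simp

theorem borelElt_injective : Function.Injective fun p : Fˣ × F => borelElt p.1 p.2 := by
  rintro ⟨a, b⟩ ⟨a', b'⟩ h
  obtain ⟨u, -, hu⟩ := exists_eq_smul_of_mk_eq_mk h
  change !![_, _; _, _] = u • !![_, _; _, _] at hu
  have h11 := congrFun (congrFun hu 1) 1
  have h00 := congrFun (congrFun hu 0) 0
  have h01 := congrFun (congrFun hu 0) 1
  simp at h11 h00 h01
  subst h11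
  simp_all [Units.ext_iff]

/-- The parametrization `t ↦ diag(t, 1)` of the split torus. -/
def splitHom (F : Type*) [Field F] : Fˣ →* PGL(2, F) where
  toFun t := borelElt t 0
  map_one' := borelElt_one_zero
  map_mul' a b := by simp [borelElt_mul]

theorem splitHom_apply (t : Fˣ) : splitHom F t = borelElt t 0 := rfl

theorem splitHom_neg_one : splitHom F (-1) = h₀ := by
  rw [splitHom_apply, borelElt, h₀]
  refine mk_eq_mk_of_eq_smul one_ne_zero ?_
  change !![_, _; _, _] = (1 : F) • !![_, _; _, _]
  simp

theorem range_splitHom : (splitHom F).range = splitTorus F := by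
  ext g
  constructor
  · rintro ⟨t, rfl⟩
    refine ⟨Units.map (Matrix.diagonalRingHom (Fin 2) F : (Fin 2 → F) →* _)
      (MulEquiv.piUnits.symm ![t, 1]), ⟨_, rfl⟩, ?_⟩
    refine mk_eq_mk_of_eq_smul one_ne_zero ?_
    change Matrix.diagonal _ = (1 : F) • !![_, _; _, _]
    ext i j
    fin_cases i <;> fin_cases j <;> simp
  · rintro ⟨_, ⟨d, rfl⟩, rfl⟩
    have h0 : (d : Fin 2 → F) 0 ≠ 0 := (MulEquiv.piUnits d 0).ne_zero
    have h1 : (d : Fin 2 → F) 1 ≠ 0 := (MulEquiv.piUnits d 1).ne_zero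
    refine ⟨Units.mk0 _ h0 / Units.mk0 _ h1, ?_⟩
    refine mk_eq_mk_of_eq_smul (inv_ne_zero h1) ?_
    change !![_, _; _, _] = _ • Matrix.diagonal (d : Fin 2 → F)
    ext i j
    fin_cases i <;> fin_cases j <;> simp [h1, div_eq_inv_mul]

/-- The entry `-0` gives the matrix the shape required by `isConj_h₀` and `isConj_k₀`, with `a = 0`.
-/
theorem k₀_mul_splitHom (α t : Fˣ) : k₀ α * splitHom F t =
    Matrix.ProjGenLinGroup.mk (.mkOfDetNeZero !![0, (α : F); t, -0] (by simp)) := by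
  rw [k₀, splitHom_apply, borelElt, ← map_mul]
  refine mk_eq_mk_of_eq_smul one_ne_zero ?_
  change !![_, _; _, _] * !![_, _; _, _] = (1 : F) • !![_, _; _, _]
  ext i j
  fin_cases i <;> fin_cases j <;> simp [Matrix.mul_apply, Fin.sum_univ_two]

theorem splitHom_mul_k₀ (α t : Fˣ) : splitHom F t * k₀ α = k₀ α * splitHom F t⁻¹ := by
  rw [k₀, splitHom_apply, splitHom_apply, borelElt, borelElt, ← map_mul, ← map_mul]
  refine mk_eq_mk_of_eq_smul t.ne_zero ?_
  change !![_, _; _, _] * !![_, _; _, _] = (t : F) • (!![_, _; _, _] * !![_, _; _, _])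
  ext i j
  fin_cases i <;> fin_cases j <;> simp [Matrix.mul_apply, Fin.sum_univ_two]

theorem k₀_mul_self (α : Fˣ) : k₀ α * k₀ α = 1 := by
  rw [k₀, ← map_mul, ← map_one Matrix.ProjGenLinGroup.mk]
  refine mk_eq_mk_of_eq_smul α.ne_zero ?_
  change !![_, _; _, _] * !![_, _; _, _] = (α : F) • (1 : Matrix (Fin 2) (Fin 2) F)
  ext i j
  fin_cases i <;> fin_cases j <;> simp [Matrix.mul_apply, Fin.sum_univ_two]

end Elements

/-! ### The quadratic extension in a basis `1, √α` -/

section QuadraticExtension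

variable {F E : Type*} [Field F] [Field E] [Algebra F E] {α : Fˣ}

/-- The basis `b` is of the form `1, √α`. -/
structure IsSqrtBasis (b : Module.Basis (Fin 2) F E) (α : Fˣ) : Prop where
  zero : b 0 = 1
  one_sq : b 1 * b 1 = algebraMap F E α

variable {b : Module.Basis (Fin 2) F E}

theorem regularEmbedding_apply (b : Module.Basis (Fin 2) F E) (e : Eˣ) : regularEmbedding b e =
    Matrix.ProjGenLinGroup.mk (Units.map (Algebra.leftMulMatrix b : E →* _) e) := rfl

namespace IsSqrtBasis

variable (hb : IsSqrtBasis b α)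
include hb

theorem eq_add (e : E) : e = algebraMap F E (b.repr e 0) + algebraMap F E (b.repr e 1) * b 1 := by
  conv_lhs => rw [← b.sum_repr e]
  simp [Fin.sum_univ_two, hb.zero, Algebra.smul_def]

theorem repr_zero (x y : F) : b.repr (algebraMap F E x + algebraMap F E y * b 1) 0 = x := by
  have : algebraMap F E x + algebraMap F E y * b 1 = x • b 0 + y • b 1 := by
    simp [hb.zero, Algebra.smul_def]
  simp [this]

theorem repr_one (x y : F) : b.repr (algebraMap F E x + algebraMap F E y * b 1) 1 = y := by
  have : algebraMap F E x + algebraMap F E y * b 1 = x • b 0 + y • b 1 := by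
    simp [hb.zero, Algebra.smul_def]
  simp [this]

theorem leftMulMatrix_eq (e : E) : Algebra.leftMulMatrix b e =
    !![b.repr e 0, α * b.repr e 1; b.repr e 1, b.repr e 0] := by
  have h1 : e * b 1 = algebraMap F E (α * b.repr e 1) + algebraMap F E (b.repr e 0) * b 1 := by
    conv_lhs => rw [hb.eq_add e]
    rw [add_mul, mul_assoc, hb.one_sq, map_mul]
    ring
  ext i j
  fin_cases j
  · fin_cases i <;> simp [Algebra.leftMulMatrix_eq_repr_mul, hb.zero]
  · rw [Algebra.leftMulMatrix_eq_repr_mul]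
    change b.repr (e * b 1) i = _
    rw [h1]
    fin_cases i
    · exact hb.repr_zero _ _
    · exact hb.repr_one _ _

theorem norm_eq (e : E) :
    Algebra.norm F e = b.repr e 0 ^ 2 - α * b.repr e 1 ^ 2 := by
  rw [Algebra.norm_eq_matrix_det b, hb.leftMulMatrix_eq, Matrix.det_fin_two_of]
  ring

/-- The second coordinate vanishes exactly when `e` lies in `F`, so the kernel is `Fˣ`. -/
theorem regularEmbedding_eq_one_iff (e : Eˣ) : regularEmbedding b e = 1 ↔ b.repr (e : E) 1 = 0 := by
  rw [regularEmbedding_apply]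
  constructor
  · intro h
    rw [← map_one Matrix.ProjGenLinGroup.mk] at h
    obtain ⟨u, -, hu⟩ := exists_eq_smul_of_mk_eq_mk h
    have := congrFun (congrFun hu 1) 0
    simpa [hb.leftMulMatrix_eq] using this
  · intro h
    have h0 : b.repr (e : E) 0 ≠ 0 := by
      intro h0
      have := hb.eq_add e
      simp [h, h0] at this
    rw [← map_one Matrix.ProjGenLinGroup.mk]
    refine mk_eq_mk_of_eq_smul h0 ?_
    ext i j
    fin_cases i <;> fin_cases j <;> simp [hb.leftMulMatrix_eq, h]

theorem range_regularEmbedding : (regularEmbedding b).range = nonsplitTorus α := by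
  ext g
  constructor
  · rintro ⟨e, rfl⟩
    exact ⟨_, ⟨_, _, hb.leftMulMatrix_eq e⟩, rfl⟩
  · rintro ⟨g, ⟨x, y, hg⟩, rfl⟩
    have he : algebraMap F E x + algebraMap F E y * b 1 ≠ 0 := by
      intro h
      have hx := hb.repr_zero x y
      have hy := hb.repr_one x y
      simp only [h, map_zero, Finsupp.coe_zero, Pi.zero_apply] at hx hy
      have hdet := (Matrix.isUnit_iff_isUnit_det _).1 g.isUnit
      rw [hg, ← hx, ← hy] at hdet
      simp at hdet
    refine ⟨Units.mk0 _ he, ?_⟩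
    rw [regularEmbedding_apply]
    refine mk_eq_mk_of_eq_smul one_ne_zero ?_
    change Algebra.leftMulMatrix b _ = _
    rw [Units.val_mk0, hb.leftMulMatrix_eq, hb.repr_zero, hb.repr_one, hg, one_smul]

/-- On `E = F²` the matrix of `h₀` is minus the Galois conjugation, so `e h₀ e = N(e) h₀`, a scalar
multiple of `h₀`. -/
theorem h₀_mul_regularEmbedding_inv (e : Eˣ) :
    regularEmbedding b e * h₀ = h₀ * regularEmbedding b e⁻¹ := by
  rw [map_inv, ← mul_inv_eq_iff_eq_mul, inv_inv, mul_assoc, regularEmbedding_apply, h₀, ← map_mul,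
    ← map_mul]
  have : Module.Finite F E := .of_basis b
  have hN : Algebra.norm F (e : E) ≠ 0 := Algebra.norm_ne_zero_iff.2 e.ne_zero
  refine mk_eq_mk_of_eq_smul hN ?_
  rw [hb.norm_eq]
  change Algebra.leftMulMatrix b (e : E) * (!![_, _; _, _] * Algebra.leftMulMatrix b (e : E)) =
    _ • !![_, _; _, _]
  rw [hb.leftMulMatrix_eq]
  ext i j
  fin_cases i <;> fin_cases j <;> simp [Matrix.mul_apply, Fin.sum_univ_two] <;> ring

/-- The double negation keeps the trace-zero shape `(a b; c -a)`; here `a² + bc = N(e)`. -/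
theorem h₀_mul_regularEmbedding (e : Eˣ) : ∃ X : GL (Fin 2) F,
    h₀ * regularEmbedding b e = Matrix.ProjGenLinGroup.mk X ∧ (X : Matrix (Fin 2) (Fin 2) F) =
      !![-b.repr (e : E) 0, -(α * b.repr (e : E) 1); b.repr (e : E) 1, - -b.repr (e : E) 0] := by
  rw [regularEmbedding_apply, h₀, ← map_mul]
  refine ⟨_, rfl, ?_⟩
  change !![_, _; _, _] * Algebra.leftMulMatrix b (e : E) = _
  rw [hb.leftMulMatrix_eq]
  ext i j
  fin_cases i <;> fin_cases j <;> simp [Matrix.mul_apply, Fin.sum_univ_two]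

end IsSqrtBasis

/-- A quadratic extension of finite fields of odd characteristic has a basis `1, √α` for each
non-square `α`. -/
theorem exists_isSqrtBasis [Fintype F] (hF : ringChar F ≠ 2) (hE : Module.finrank F E = 2)
    (hα : ¬ IsSquare (α : F)) : ∃ b : Module.Basis (Fin 2) F E, IsSqrtBasis b α := by
  have : FiniteDimensional F E := .of_finrank_pos (by omega)
  have : Finite E := Module.finite_of_finite F
  have := Fintype.ofFinite E
  have hchar : ringChar E ≠ 2 := by rwa [← Algebra.ringChar_eq F E]
  obtain ⟨s, hs⟩ : IsSquare (algebraMap F E α) := by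
    rw [FiniteField.isSquare_iff hchar (by simp), Module.card_eq_pow_finrank (K := F), hE]
    have hodd := FiniteField.odd_card_of_char_ne_two hF
    obtain ⟨k, hk⟩ : ∃ k, Fintype.card F = 2 * k + 1 := ⟨Fintype.card F / 2, by omega⟩
    -- The natural-number quotient is `(q² - 1)/2 = (q - 1)(q + 1)/2`, so Euler's criterion in `E`
    -- follows from `α^(q-1) = 1`.
    have : Fintype.card F ^ 2 / 2 = (Fintype.card F - 1) * (k + 1) := by
      rw [hk]
      have : (2 * k + 1) ^ 2 = 2 * ((2 * k) * (k + 1)) + 1 := by ring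
      rw [this, Nat.add_sub_cancel]
      omega
    rw [this, pow_mul, ← map_pow, FiniteField.pow_card_sub_one_eq_one _ α.ne_zero, map_one, one_pow]
  have hli : LinearIndependent F ![1, s] := by
    rw [LinearIndependent.pair_iff]
    intro x y hxy
    by_cases hy : y = 0
    · subst hy
      simpa using hxy
    · exfalso
      apply hα
      have hsx : s = algebraMap F E (-x / y) := by
        have hy' : algebraMap F E y ≠ 0 := by simpa using hy
        rw [Algebra.smul_def, Algebra.smul_def] at hxy
        rw [map_div₀, map_neg, eq_div_iff hy']
        linear_combination hxy
      refine ⟨-x / y, (algebraMap F E).injective ?_⟩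
      rw [hs, map_mul, ← hsx]
  refine ⟨basisOfLinearIndependentOfCardEqFinrank hli (by simp [hE]), ?_, ?_⟩
  · simp
  · simp [hs]

end QuadraticExtension

/-! ### The common sign and multiplicity one -/

section Sign

open scoped Classical

variable {F E V : Type*} [Field F] [Fintype F] [Field E] [Fintype E] [Algebra F E] {α : Fˣ}
  {b : Module.Basis (Fin 2) F E} [AddCommGroup V] [Module ℂ V]

instance : Finite PGL(2, F) := Finite.of_surjective _ Matrix.ProjGenLinGroup.mk_surjective

/-- The quadratic character of a finite field, with complex values. -/
def quadraticHom (F : Type*) [Field F] [Fintype F] : Fˣ →* ℂ :=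
  ((Int.castRingHom ℂ : ℤ →* ℂ).comp (quadraticChar F).toMonoidHom).comp (Units.coeHom F)

theorem quadraticHom_of_isSquare {t : Fˣ} (ht : IsSquare (t : F)) : quadraticHom F t = 1 := by
  have := (quadraticChar_one_iff_isSquare t.ne_zero).2 ht
  change ((quadraticChar F t : ℤ) : ℂ) = 1
  rw [this, Int.cast_one]

theorem quadraticHom_of_not_isSquare {t : Fˣ} (ht : ¬ IsSquare (t : F)) :
    quadraticHom F t = -1 := by
  have := quadraticChar_neg_one_iff_not_isSquare.2 ht
  change ((quadraticChar F t : ℤ) : ℂ) = -1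
  rw [this, Int.cast_neg, Int.cast_one]

theorem exists_eq_mul_sq {x : F} (hα : ¬ IsSquare (α : F))
    (hx : ¬ IsSquare x) : ∃ e : F, e ≠ 0 ∧ x = α * e ^ 2 := by
  have hx0 : x ≠ 0 := by rintro rfl; exact hx (IsSquare.zero)
  have h1 := quadraticChar_neg_one_iff_not_isSquare.2 hx
  have h2 := quadraticChar_neg_one_iff_not_isSquare.2 hα
  have h3 : quadraticChar F (α * x) = 1 := by rw [map_mul, h1, h2]; norm_num
  obtain ⟨r, hr⟩ := (quadraticChar_one_iff_isSquare (mul_ne_zero α.ne_zero hx0)).1 h3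
  have hα0 := α.ne_zero
  refine ⟨r / α, ?_, ?_⟩
  · rintro h
    have : r = 0 := by simpa using h
    simp [this, hx0] at hr
  · field_simp
    linear_combination hr

theorem character_eq_of_isConj {G : Type*} [Group G] (π : Representation ℂ G V) {g h : G}
    (hgh : IsConj g h) : π.character h = π.character g := by
  obtain ⟨c, rfl⟩ := isConj_iff.1 hgh
  exact π.char_conj g c

/-- Here `-det = αt`, so the element is conjugate to `k₀` if `t` is a square and to `h₀` otherwise.
Writing this with the quadratic character makes the second term cancel on summation. -/
theorem character_k₀_mul_splitHom (hF : ringChar F ≠ 2) (hα : ¬ IsSquare (α : F))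
    (π : Representation ℂ PGL(2, F) V) (t : Fˣ) :
    π.character (k₀ α * splitHom F t) = (π.character h₀ + π.character (k₀ α)) / 2 +
      quadraticHom F t * ((π.character (k₀ α) - π.character h₀) / 2) := by
  rw [k₀_mul_splitHom]
  by_cases ht : IsSquare (t : F)
  · rw [quadraticHom_of_isSquare ht]
    obtain ⟨r, hr⟩ := ht
    have hr0 : r ≠ 0 := by rintro rfl; simp at hr
    rw [character_eq_of_isConj π (isConj_k₀ (α := α) (e := r) rfl t.ne_zero hr0
      (by rw [hr]; ring))]
    ring
  · rw [quadraticHom_of_not_isSquare ht]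
    obtain ⟨r, hr0, hr⟩ := exists_eq_mul_sq hα ht
    rw [character_eq_of_isConj π (isConj_h₀ (e := α * r) (Ring.two_ne_zero hF) rfl t.ne_zero
      (mul_ne_zero α.ne_zero hr0) (by rw [hr]; ring))]
    ring

omit [Fintype E] in
theorem character_h₀_mul_regularEmbedding (hF : ringChar F ≠ 2) (hα : ¬ IsSquare (α : F))
    (hb : IsSqrtBasis b α) (π : Representation ℂ PGL(2, F) V) (e : Eˣ) :
    π.character (h₀ * regularEmbedding b e) = (π.character h₀ + π.character (k₀ α)) / 2 +
      quadraticHom F (Units.map (Algebra.norm F) e) *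
        ((π.character h₀ - π.character (k₀ α)) / 2) := by
  obtain ⟨X, hX, hX'⟩ := hb.h₀_mul_regularEmbedding e
  have hN : ((Units.map (Algebra.norm F) e : Fˣ) : F) = _ := hb.norm_eq e
  have hN0 := (Units.map (Algebra.norm F) e : Fˣ).ne_zero
  -- The conjugacy lemmas need a nonzero lower-left entry. If it vanishes, `e` lies in `F`, its norm
  -- is a square and the element is `h₀` itself.
  by_cases hn : b.repr (e : E) 1 = 0
  · rw [quadraticHom_of_isSquare (by rw [hN, hn]; simp [sq]),
      (hb.regularEmbedding_eq_one_iff e).2 hn, mul_one]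
    ring
  rw [hX]
  by_cases ht : IsSquare ((Units.map (Algebra.norm F) e : Fˣ) : F)
  · rw [quadraticHom_of_isSquare ht]
    obtain ⟨r, hr⟩ := ht
    have hr0 : r ≠ 0 := by rintro rfl; simp [hr] at hN0
    rw [character_eq_of_isConj π (isConj_h₀ (e := r) (Ring.two_ne_zero hF) hX' hn hr0
      (by rw [hN] at hr; linear_combination hr))]
    ring
  · rw [quadraticHom_of_not_isSquare ht]
    obtain ⟨r, hr0, hr⟩ := exists_eq_mul_sq hα ht
    rw [character_eq_of_isConj π (isConj_k₀ (α := α) (e := r) hX' hn hr0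
      (by rw [hN] at hr; linear_combination hr))]
    ring

theorem quadraticHom_ne_one (hα : ¬ IsSquare (α : F)) : quadraticHom F ≠ 1 := by
  intro h
  have := quadraticHom_of_not_isSquare hα
  rw [h] at this
  norm_num at this

omit [Fintype F] in
-- The norm between finite fields is surjective on units.
theorem comp_norm_ne_one {M : Type*} [Monoid M] {c : Fˣ →* M} (hc : c ≠ 1) :
    c.comp (Units.map (Algebra.norm F : E →* F)) ≠ 1 := by
  intro h
  apply hc
  ext t
  obtain ⟨e, rfl⟩ := FiniteField.unitsMap_norm_surjective F E t
  exact DFunLike.congr_fun h e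

/-- Each sign is a coset average. The quadratic character sums to zero over `Fˣ`, and so does its
composite with the norm over `Eˣ`, leaving the same constant in both. -/
theorem hasCommonSign_of_multiplicityOne [FiniteDimensional ℂ V] (hF : ringChar F ≠ 2)
    (hα : ¬ IsSquare (α : F)) (hb : IsSqrtBasis b α) (π : Representation ℂ PGL(2, F) V)
    (h : MultiplicityOne α π) :
    HasCommonSign α π ((π.character h₀ + π.character (k₀ α)) / 2) := by
  obtain ⟨hH, hK⟩ := h
  constructor
  · intro v hv
    rw [← range_splitHom] at hH hv
    rw [apply_eq_average_smul _ π (k₀ α) (fun t => ⟨_, splitHom_mul_k₀ α t⟩) hH hv]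
    simp_rw [character_k₀_mul_splitHom hF hα π, Finset.sum_add_distrib, ← Finset.sum_mul,
      sum_hom_units_eq_zero _ (quadraticHom_ne_one hα)]
    simp
  · intro v hv
    rw [← hb.range_regularEmbedding] at hK hv
    rw [apply_eq_average_smul _ π h₀ (fun t => ⟨_, hb.h₀_mul_regularEmbedding_inv t⟩) hK hv]
    have hsum : ∑ e : Eˣ, quadraticHom F (Units.map (Algebra.norm F) e) = 0 :=
      sum_hom_units_eq_zero _ (comp_norm_ne_one (E := E) (quadraticHom_ne_one hα))
    simp_rw [character_h₀_mul_regularEmbedding hF hα hb π, Finset.sum_add_distrib,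
      ← Finset.sum_mul, hsum]
    simp

omit [Fintype F] in
theorem sign_eq_one_or_neg_one {π : Representation ℂ PGL(2, F) V} {ε : ℂ}
    (h : MultiplicityOne α π) (hε : HasCommonSign α π ε) : ε = 1 ∨ ε = -1 := by
  obtain ⟨v, hv, -⟩ := finrank_eq_one_iff'.1 h.1
  have h1 := hε.1 v v.2
  have h2 : π (k₀ α) (π (k₀ α) v) = v := by
    rw [← Module.End.mul_apply, ← map_mul, k₀_mul_self, map_one, Module.End.one_apply]
  rw [h1, map_smul, h1, smul_smul] at h2
  have hv' : (v : V) ≠ 0 := by simpa using hv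
  have : (ε * ε - 1) • (v : V) = 0 := by rw [sub_smul, h2, one_smul, sub_self]
  rcases smul_eq_zero.1 this with h | h
  · exact mul_self_eq_one_iff.1 (sub_eq_zero.1 h)
  · exact absurd h hv'

theorem card_units_cast : (Fintype.card Fˣ : ℂ) = Fintype.card F - 1 := by
  rw [Fintype.card_units, Nat.cast_sub Fintype.card_pos, Nat.cast_one]

theorem sum_ite_regularEmbedding_eq_one (hb : IsSqrtBasis b α) (c : ℂ) :
    ∑ e : Eˣ, (if regularEmbedding b e = 1 then c else 0) = (Fintype.card F - 1) * c := by
  rw [← card_units_cast, ← Finset.sum_filter, Finset.sum_const, nsmul_eq_mul]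
  congr 2
  symm
  refine Finset.card_bij (fun t _ => Units.map (algebraMap F E : F →* E) t) ?_ ?_ ?_
  · intro t _
    rw [Finset.mem_filter, hb.regularEmbedding_eq_one_iff]
    have := hb.repr_one (t : F) 0
    simp only [map_zero, zero_mul, add_zero] at this
    simpa using this
  · intro t _ t' _ h
    ext
    exact (algebraMap F E).injective (congrArg Units.val h)
  · intro e he
    rw [Finset.mem_filter, hb.regularEmbedding_eq_one_iff] at he
    have := hb.eq_add (e : E)
    rw [he.2, RingHom.map_zero, zero_mul, add_zero] at this
    have h0 : b.repr (e : E) 0 ≠ 0 := by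
      intro h
      simp [h] at this
    exact ⟨Units.mk0 _ h0, Finset.mem_univ _, Units.ext this.symm⟩

theorem card_eq_sq (b : Module.Basis (Fin 2) F E) : Fintype.card E = Fintype.card F ^ 2 := by
  rw [Module.card_fintype b, Fintype.card_fin]

/-- Multiplicity one, and the value of the sign, from the values of the character. -/
theorem multiplicityOne_and_hasCommonSign [FiniteDimensional ℂ V] (hF : ringChar F ≠ 2)
    (hα : ¬ IsSquare (α : F)) (hb : IsSqrtBasis b α) (π : Representation ℂ PGL(2, F) V)
    {f : Fˣ → ℂ} {g : Eˣ → ℂ} (hf : ∑ t, f t = 0) (hg : ∑ e, g e = 0)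
    (hπf : ∀ t, π.character (splitHom F t) =
      f t + if splitHom F t = 1 then (Fintype.card F : ℂ) - 1 else 0)
    (hπg : ∀ e, π.character (regularEmbedding b e) =
      g e + if regularEmbedding b e = 1 then (Fintype.card F : ℂ) + 1 else 0)
    {ε : ℂ} (hε : (π.character h₀ + π.character (k₀ α)) / 2 = ε) :
    MultiplicityOne α π ∧ HasCommonSign α π ε := by
  -- The terms supported at `1` are the regular characters of `H` and `K`, of orders `q - 1` and `q
  -- + 1`; `f` and `g` contribute nothing to the averages.
  have hm : MultiplicityOne α π := by
    constructor
    · rw [← range_splitHom]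
      have := finrank_fixedSpace_range (splitHom F) π
      have h1 : ∀ t : Fˣ, splitHom F t = 1 ↔ t = 1 := fun t => by
        rw [← map_one (splitHom F), splitHom_apply, splitHom_apply]
        refine ⟨fun h => ?_, fun h => by rw [h]⟩
        exact congrArg Prod.fst (@borelElt_injective F _ (t, 0) (1, 0) h)
      have h0 : (Fintype.card Fˣ : ℂ) ≠ 0 := by simp
      simp_rw [hπf, Finset.sum_add_distrib, hf, h1] at this
      rw [Finset.sum_ite_eq' Finset.univ, if_pos (Finset.mem_univ _), zero_add, ← card_units_cast,
        inv_mul_cancel₀ h0] at this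
      exact_mod_cast this
    · rw [← hb.range_regularEmbedding]
      have := finrank_fixedSpace_range (regularEmbedding b) π
      have h0 : (Fintype.card Eˣ : ℂ) ≠ 0 := by simp
      have h1 : (Fintype.card Eˣ : ℂ) =
          ((Fintype.card F : ℂ) - 1) * ((Fintype.card F : ℂ) + 1) := by
        rw [card_units_cast, card_eq_sq b]
        push_cast
        ring
      simp_rw [hπg, Finset.sum_add_distrib, hg] at this
      rw [sum_ite_regularEmbedding_eq_one hb, zero_add, ← h1, inv_mul_cancel₀ h0] at this
      exact_mod_cast this
  exact ⟨hm, hε ▸ hasCommonSign_of_multiplicityOne hF hα hb π hm⟩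

end Sign

/-! ### Conjugates of torus elements -/

section Conjugation

variable {F E : Type*} [Field F] [Field E] [Algebra F E] {α : Fˣ} {b : Module.Basis (Fin 2) F E}

theorem det_ne_zero' (X : GL (Fin 2) F) : X.1 0 0 * X.1 1 1 - X.1 0 1 * X.1 1 0 ≠ 0 := by
  rw [← Matrix.det_fin_two]
  exact ((Matrix.isUnit_iff_isUnit_det _).1 X.isUnit).ne_zero

theorem mk_eq_borelElt_iff (X : GL (Fin 2) F) :
    (∃ a c, Matrix.ProjGenLinGroup.mk X = borelElt a c) ↔ X.1 1 0 = 0 := by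
  constructor
  · rintro ⟨a, c, h⟩
    obtain ⟨u, -, hu⟩ := exists_eq_smul_of_mk_eq_mk h
    change X.1 = u • !![_, _; _, _] at hu
    simp [hu]
  · intro h
    have hdet := det_ne_zero' X
    rw [h, mul_zero, sub_zero] at hdet
    have h0 := left_ne_zero_of_mul hdet
    have h1 := right_ne_zero_of_mul hdet
    refine ⟨Units.mk0 _ (div_ne_zero h0 h1), X.1 0 1 / X.1 1 1, mk_eq_mk_of_eq_smul h1 ?_⟩
    change X.1 = _ • !![_, _; _, _]
    ext i j
    fin_cases i <;> fin_cases j <;> simp [h] <;> field_simp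

theorem exists_smul_of_conj_borelElt {X Y : GL (Fin 2) F} {a : Fˣ} {c : F}
    (h : Matrix.ProjGenLinGroup.mk X * Matrix.ProjGenLinGroup.mk Y *
      (Matrix.ProjGenLinGroup.mk X)⁻¹ = borelElt a c) :
    ∃ v : F, v ≠ 0 ∧ X.1 * Y.1 = v • (!![(a : F), c; 0, 1] * X.1) := by
  rw [mul_inv_eq_iff_eq_mul, borelElt, ← map_mul, ← map_mul] at h
  exact exists_eq_smul_of_mk_eq_mk h

/-- Otherwise the bottom row of a representative of `x` would be a left eigenvector of
multiplication by `e`. As `e` is not in `F`, the ratio of its entries would be a square root of `α`.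
-/
theorem conj_regularEmbedding_ne_borelElt (hα : ¬ IsSquare (α : F)) (hb : IsSqrtBasis b α)
    {e : Eˣ} (he : regularEmbedding b e ≠ 1) (x : PGL(2, F)) (a : Fˣ) (c : F) :
    x * regularEmbedding b e * x⁻¹ ≠ borelElt a c := by
  induction x using Matrix.ProjGenLinGroup.induction_on with | mk X =>
  intro h
  rw [regularEmbedding_apply] at h
  obtain ⟨v, -, hv⟩ := exists_smul_of_conj_borelElt h
  rw [Ne, hb.regularEmbedding_eq_one_iff] at he
  change X.1 * Algebra.leftMulMatrix b (e : E) = _ at hv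
  rw [hb.leftMulMatrix_eq] at hv
  have h0 := congrFun (congrFun hv 1) 0
  have h1 := congrFun (congrFun hv 1) 1
  simp [Matrix.mul_apply, Fin.sum_univ_two, -Matrix.cons_mul] at h0 h1
  have h2 : X.1 1 1 ^ 2 = α * X.1 1 0 ^ 2 := by
    apply mul_left_cancel₀ he
    linear_combination X.1 1 1 * h0 - X.1 1 0 * h1
  have hdet := det_ne_zero' X
  by_cases hs : X.1 1 0 = 0
  · have hu : X.1 1 1 = 0 := by simpa [hs] using h2
    simp [hs, hu] at hdet
  · refine hα ⟨X.1 1 1 / X.1 1 0, ?_⟩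
    field_simp
    linear_combination -h2

/-- The bottom row of a representative of `x` is a left eigenvector of `diag(t, 1)`, so one of its
entries vanishes. Right multiplication by the Weyl element `k₀ 1` swaps the columns. -/
theorem eq_borelElt_or_of_conj_splitHom {t : Fˣ} (ht : t ≠ 1) {x : PGL(2, F)} {a : Fˣ} {c : F}
    (h : x * splitHom F t * x⁻¹ = borelElt a c) :
    (∃ a' c', x = borelElt a' c') ∨ ∃ a' c', x * k₀ 1 = borelElt a' c' := by
  induction x using Matrix.ProjGenLinGroup.induction_on with | mk X =>
  obtain ⟨v, -, hv⟩ := exists_smul_of_conj_borelElt h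
  rw [k₀, ← map_mul, mk_eq_borelElt_iff, mk_eq_borelElt_iff]
  change _ * !![_, _; _, _] = _ at hv
  change _ ∨ (X.1 * !![_, _; _, _] : Matrix (Fin 2) (Fin 2) F) 1 0 = 0
  have h0 := congrFun (congrFun hv 1) 0
  have h1 := congrFun (congrFun hv 1) 1
  simp [Matrix.mul_apply, Fin.sum_univ_two, -Matrix.cons_mul] at h0 h1 ⊢
  by_contra! hne
  apply ht
  ext
  apply mul_left_cancel₀ hne.1
  have hv1 : v = 1 := mul_right_cancel₀ hne.2 (by rw [one_mul]; exact h1.symm)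
  rw [h0, hv1]
  simp

theorem borelElt_conj_splitHom (a t : Fˣ) (c : F) :
    borelElt a c * splitHom F t * (borelElt a c)⁻¹ = borelElt t (c - t * c) := by
  rw [mul_inv_eq_iff_eq_mul, splitHom_apply, borelElt_mul, borelElt_mul, mul_comm]
  congr 1
  ring

theorem conj_splitHom_of_mul_k₀ {x : PGL(2, F)} {a : Fˣ} {c : F} (h : x * k₀ 1 = borelElt a c)
    (t : Fˣ) : x * splitHom F t * x⁻¹ = borelElt t⁻¹ (c - (t⁻¹ : Fˣ) * c) := by
  rw [← borelElt_conj_splitHom a, ← h, mul_inv_rev, mul_assoc x (k₀ 1), ← splitHom_mul_k₀]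
  group

theorem not_eq_borelElt_and (x : PGL(2, F)) : ¬ ((∃ a c, x = borelElt a c) ∧
    ∃ a c, x * k₀ 1 = borelElt a c) := by
  induction x using Matrix.ProjGenLinGroup.induction_on with | mk X =>
  rw [k₀, ← map_mul, mk_eq_borelElt_iff, mk_eq_borelElt_iff]
  change ¬ (_ ∧ (X.1 * !![_, _; _, _] : Matrix (Fin 2) (Fin 2) F) 1 0 = 0)
  have hdet := det_ne_zero' X
  rintro ⟨h0, h1⟩
  simp [Matrix.mul_apply, Fin.sum_univ_two, -Matrix.cons_mul] at h0 h1
  simp [h0, h1] at hdet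

theorem conj_splitHom_ne_borelElt_one {t : Fˣ} (ht : t ≠ 1) (x : PGL(2, F)) (c : F) :
    x * splitHom F t * x⁻¹ ≠ borelElt 1 c := by
  intro h
  rcases eq_borelElt_or_of_conj_splitHom ht h with ⟨a', c', h'⟩ | ⟨a', c', h'⟩
  · rw [h', borelElt_conj_splitHom] at h
    exact ht (congrArg Prod.fst (@borelElt_injective F _ (t, _) (1, c) h))
  · rw [conj_splitHom_of_mul_k₀ h'] at h
    exact ht (inv_eq_one.1 (congrArg Prod.fst (@borelElt_injective F _ (t⁻¹, _) (1, c) h)))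

theorem splitHom_eq_one_iff {t : Fˣ} : splitHom F t = 1 ↔ t = 1 := by
  rw [← map_one (splitHom F), splitHom_apply, splitHom_apply]
  exact ⟨fun h => congrArg Prod.fst (@borelElt_injective F _ (t, 0) (1, 0) h), fun h => by rw [h]⟩

theorem conj_splitHom_ne_regularEmbedding (hα : ¬ IsSquare (α : F)) (hb : IsSqrtBasis b α)
    {t : Fˣ} (ht : t ≠ 1) (x : PGL(2, F)) (e : Eˣ) :
    x * splitHom F t * x⁻¹ ≠ regularEmbedding b e := by
  intro h
  refine conj_regularEmbedding_ne_borelElt hα hb (e := e) ?_ x⁻¹ t 0 ?_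
  · rw [← h, Ne, conj_eq_one_iff, splitHom_eq_one_iff]
    exact ht
  · rw [← h, ← splitHom_apply]
    group

/-- Up to a scalar, conjugation by `x` fixes the `F`-part of `e` and multiplies the `√α`-part by a
sign. So a representative commutes with `√α`, hence lies in the torus, or anticommutes with it, as
`h₀` does. -/
theorem mem_range_or_of_conj_regularEmbedding (h2 : (2 : F) ≠ 0) (hb : IsSqrtBasis b α)
    {e e' : Eˣ} (he : regularEmbedding b e ≠ 1) {x : PGL(2, F)}
    (h : regularEmbedding b e' = x * regularEmbedding b e * x⁻¹) :
    x ∈ (regularEmbedding b).range ∨ x * h₀ ∈ (regularEmbedding b).range := by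
  induction x using Matrix.ProjGenLinGroup.induction_on with | mk X =>
  rw [hb.range_regularEmbedding]
  rw [Ne, hb.regularEmbedding_eq_one_iff] at he
  rw [eq_comm, mul_inv_eq_iff_eq_mul, regularEmbedding_apply, regularEmbedding_apply, ← map_mul,
    ← map_mul] at h
  obtain ⟨v, -, hv⟩ := exists_eq_smul_of_mk_eq_mk h
  change X.1 * Algebra.leftMulMatrix b (e : E) = v • (Algebra.leftMulMatrix b (e' : E) * X.1) at hv
  rw [hb.leftMulMatrix_eq, hb.leftMulMatrix_eq] at hv
  have hdet := det_ne_zero' X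
  have h00 := congrFun (congrFun hv 0) 0
  have h01 := congrFun (congrFun hv 0) 1
  have h10 := congrFun (congrFun hv 1) 0
  have h11 := congrFun (congrFun hv 1) 1
  simp [Matrix.mul_apply, Fin.sum_univ_two, -Matrix.cons_mul] at h00 h01 h10 h11
  have hα0 := α.ne_zero
  have hX : X.1 = !![X.1 0 0, X.1 0 1; X.1 1 0, X.1 1 1] := Matrix.eta_fin_two _
  generalize X.1 0 0 = p at *
  generalize X.1 0 1 = r at *
  generalize X.1 1 0 = s at *
  generalize X.1 1 1 = u at *
  generalize b.repr (e : E) 0 = m at *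
  generalize b.repr (e : E) 1 = n at *
  -- The projective scalar `v` is absorbed into the coordinates of `e'`.
  obtain ⟨m', hm'⟩ : ∃ m', m' = v * b.repr (e' : E) 0 := ⟨_, rfl⟩
  obtain ⟨n', hn'⟩ : ∃ n', n' = v * b.repr (e' : E) 1 := ⟨_, rfl⟩
  -- Equality of traces, multiplied by the determinant of `X`.
  have hm : m = m' := by
    apply mul_left_cancel₀ (mul_ne_zero h2 hdet)
    linear_combination u * h00 - s * h01 - r * h10 + p * h11 - 2 * (p * u - r * s) * hm'
  have e00 : r * n = α * n' * s := by linear_combination h00 - p * hm' - p * hm - α * s * hn'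
  have e01 : p * n = n' * u := by
    apply mul_left_cancel₀ hα0
    linear_combination h01 - r * hm' - r * hm - α * u * hn'
  have e10 : u * n = n' * p := by linear_combination h10 - s * hm' - s * hm - p * hn'
  have e11 : s * α * n = n' * r := by linear_combination h11 - u * hm' - u * hm - r * hn'
  have hnn : n' = n ∨ n' = -n := by
    rw [← sq_eq_sq_iff_eq_or_eq_neg]
    apply mul_left_cancel₀ hdet
    have f1 : p * n ^ 2 = p * n' ^ 2 := by linear_combination n * e01 + n' * e10
    have f2 : r * n ^ 2 = r * n' ^ 2 := by linear_combination n * e00 + n' * e11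
    linear_combination s * f2 - u * f1
  rcases hnn with rfl | rfl
  · left
    have g1 : p = u := mul_right_cancel₀ he (by linear_combination e01)
    have g2 : r = α * s := mul_right_cancel₀ he (by linear_combination e00)
    refine ⟨X, ⟨p, s, ?_⟩, rfl⟩
    rw [hX, g1, g2]
  · right
    have g1 : u = -p := mul_right_cancel₀ he (by linear_combination e10)
    have g2 : r = -(α * s) := mul_right_cancel₀ he (by linear_combination e00)
    rw [h₀, ← map_mul]
    refine ⟨_, ⟨-p, -s, ?_⟩, rfl⟩
    change X.1 * !![_, _; _, _] = _
    rw [hX, g1, g2]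
    ext i j
    fin_cases i <;> fin_cases j <;> simp [Matrix.mul_apply, Fin.sum_univ_two]

theorem h₀_notMem_range (h2 : (2 : F) ≠ 0) (hb : IsSqrtBasis b α) :
    h₀ ∉ (regularEmbedding b).range := by
  rw [hb.range_regularEmbedding]
  rintro ⟨g, ⟨x, y, hg⟩, h⟩
  obtain ⟨u, hu0, hu⟩ := exists_eq_smul_of_mk_eq_mk h
  rw [hg] at hu
  change _ = u • !![_, _; _, _] at hu
  have h00 := congrFun (congrFun hu 0) 0
  have h11 := congrFun (congrFun hu 1) 1
  simp at h00 h11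
  apply mul_ne_zero h2 hu0
  linear_combination h00 - h11

theorem h₀_mul_self : (h₀ : PGL(2, F)) * h₀ = 1 := by
  rw [← splitHom_neg_one, ← map_mul, neg_mul_neg, one_mul, map_one]

theorem regularEmbedding_sqrt (hb : IsSqrtBasis b α) (s : Eˣ) (hs : (s : E) = b 1) :
    regularEmbedding b s = k₀ α := by
  rw [regularEmbedding_apply, k₀]
  refine mk_eq_mk_of_eq_smul one_ne_zero ?_
  change Algebra.leftMulMatrix b (s : E) = (1 : F) • !![_, _; _, _]
  rw [hb.leftMulMatrix_eq, hs]
  simp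

theorem k₀_ne_one (α : Fˣ) : k₀ α ≠ 1 := by
  rw [k₀, ← map_one Matrix.ProjGenLinGroup.mk]
  intro h
  obtain ⟨u, hu0, hu⟩ := exists_eq_smul_of_mk_eq_mk h
  change !![_, _; _, _] = _ at hu
  have := congrFun (congrFun hu 1) 0
  simp at this

/-- The regular embeddings for two bases are conjugate. -/
theorem exists_conj_regularEmbedding (b b' : Module.Basis (Fin 2) F E) :
    ∃ P : PGL(2, F), ∀ e, regularEmbedding b' e = P * regularEmbedding b e * P⁻¹ := by
  let P : GL (Fin 2) F := ⟨b'.toMatrix b, b.toMatrix b', b'.toMatrix_mul_toMatrix_flip b,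
    b.toMatrix_mul_toMatrix_flip b'⟩
  refine ⟨Matrix.ProjGenLinGroup.mk P, fun e => ?_⟩
  rw [regularEmbedding_apply, regularEmbedding_apply, ← map_mul, ← map_inv, ← map_mul]
  congr 1
  ext1
  exact (basis_toMatrix_mul_linearMap_toMatrix_mul_basis_toMatrix b' b b' b _).symm

end Conjugation

/-! ### Characters of the principal series and of induced representations -/

section Characters

open scoped Classical

variable {F E : Type*} [Field F] [Fintype F] [Field E] [Fintype E] [Algebra F E] {α : Fˣ}
  {b : Module.Basis (Fin 2) F E}

instance : Fintype PGL(2, F) := Fintype.ofFinite _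

theorem card_PGL : (Fintype.card PGL(2, F) : ℂ) =
    (Fintype.card F - 1) * (Fintype.card F * (Fintype.card F + 1)) := by
  have h1 : Nat.card (GL (Fin 2) F) =
      Nat.card PGL(2, F) * Nat.card (Subgroup.center (GL (Fin 2) F)) :=
    Subgroup.card_eq_card_quotient_mul_card_subgroup _
  have hinj : Function.Injective (Matrix.GeneralLinearGroup.scalar (R := F) (Fin 2)) := by
    intro u v h
    have := congrArg (fun g : GL (Fin 2) F => g.1 0 0) h
    ext
    simpa using this
  have h2 : Nat.card (Subgroup.center (GL (Fin 2) F)) = Fintype.card Fˣ := by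
    rw [Matrix.GeneralLinearGroup.center_eq_range_scalar, ← Nat.card_eq_fintype_card]
    exact Nat.card_range_of_injective hinj
  rw [Matrix.card_GL_field, h2, Nat.card_eq_fintype_card] at h1
  simp only [Fin.prod_univ_two, Fin.val_zero, Fin.val_one, pow_zero, pow_one] at h1
  have hq : 1 ≤ Fintype.card F := Fintype.card_pos
  have h3 := congrArg (Nat.cast : ℕ → ℂ) h1
  rw [Nat.cast_mul, Nat.cast_mul, card_units_cast, Nat.cast_sub (Nat.one_le_pow _ _ hq),
    Nat.cast_sub (Nat.le_self_pow two_ne_zero _)] at h3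
  have hq1 : (Fintype.card F : ℂ) - 1 ≠ 0 := by rw [← card_units_cast]; simp
  apply mul_right_cancel₀ hq1
  rw [← h3]
  push_cast
  ring

theorem card_ne_zero' : (Fintype.card F : ℂ) ≠ 0 := by simp

theorem card_sub_one_ne_zero : (Fintype.card F : ℂ) - 1 ≠ 0 := by
  rw [← card_units_cast]; simp

omit [Field F] in
theorem card_add_one_ne_zero : (Fintype.card F : ℂ) + 1 ≠ 0 := 
  Nat.cast_add_one_ne_zero _

/-- The index set `Fˣ × F` only parametrizes the Borel subgroup, since its product structure is not
the group law; hence `character_of_projector` in place of `character_coind`. -/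
theorem character_principalSeries (χ : Fˣ →* ℂˣ) (g : PGL(2, F)) :
    (principalSeries χ).character g = ∑ x, ∑ p : Fˣ × F, if borelElt p.1 p.2 = x * g * x⁻¹ then
      (Fintype.card (Fˣ × F) : ℂ)⁻¹ * (χ p.1 : ℂ) else 0 := by
  refine character_of_projector (principalSeries χ) (fun _ _ _ => rfl)
    (fun p : Fˣ × F => borelElt p.1 p.2) (fun p => (Fintype.card (Fˣ × F) : ℂ)⁻¹ * (χ p.1 : ℂ))
    ?_ ?_ g
  · intro f a c x
    rw [Finset.mul_sum]
    have hinj : Function.Injective fun p : Fˣ × F => (a * p.1, (a : F) * p.2 + c) := by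
      rintro ⟨a₁, c₁⟩ ⟨a₂, c₂⟩ h
      simpa using h
    refine (Fintype.sum_bijective _ (Finite.injective_iff_bijective.1 hinj) _ _ fun p => ?_).symm
    dsimp only
    rw [← borelElt_mul, mul_inv_rev, mul_assoc (borelElt p.1 p.2)⁻¹, inv_mul_cancel_left, map_mul,
      Units.val_mul]
    ring
  · intro f hf x
    have : ∀ p : Fˣ × F, (χ p.1 : ℂ) * f ((borelElt p.1 p.2)⁻¹ * x) = f x := fun p => by
      rw [← hf p.1 p.2, mul_inv_cancel_left]
    simp [mul_assoc, this]

theorem sum_ite_borelElt_eq {f : Fˣ → ℂ} (a : Fˣ) (c : F) :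
    ∑ p : Fˣ × F, (if borelElt p.1 p.2 = borelElt a c then f p.1 else 0) = f a := by
  rw [Finset.sum_eq_single (a, c)]
  · simp
  · intro p _ hp
    rw [if_neg]
    exact fun h => hp (borelElt_injective h)
  · simp

theorem sum_ite_borelElt_eq_one (c : ℂ) :
    ∑ x : PGL(2, F), (if ∃ a c, x = borelElt a c then c else 0) =
      Fintype.card (Fˣ × F) * c := by
  rw [← Finset.sum_filter, Finset.sum_const, nsmul_eq_mul]
  congr 2
  rw [← Finset.card_univ, ← Finset.card_image_of_injective _ borelElt_injective]
  congr 1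
  ext x
  simp [eq_comm]

theorem card_borel : (Fintype.card (Fˣ × F) : ℂ) = (Fintype.card F - 1) * Fintype.card F := by
  rw [Fintype.card_prod, Nat.cast_mul, card_units_cast]

theorem character_principalSeries_one (χ : Fˣ →* ℂˣ) :
    (principalSeries χ).character 1 = Fintype.card F + 1 := by
  rw [character_principalSeries]
  simp_rw [mul_one, mul_inv_cancel, ← borelElt_one_zero (F := F)]
  rw [Finset.sum_congr rfl fun _ _ => sum_ite_borelElt_eq
    (f := fun a => (Fintype.card (Fˣ × F) : ℂ)⁻¹ * (χ a : ℂ)) 1 0]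
  rw [Finset.sum_const, Finset.card_univ, nsmul_eq_mul, card_PGL, card_borel]
  have := card_ne_zero' (F := F)
  have := card_sub_one_ne_zero (F := F)
  simp only [map_one, Units.val_one, mul_one]
  field_simp

theorem character_principalSeries_splitHom (χ : Fˣ →* ℂˣ) {t : Fˣ} (ht : t ≠ 1) :
    (principalSeries χ).character (splitHom F t) = (χ t : ℂ) + (χ t⁻¹ : ℂ) := by
  set N : ℂ := (Fintype.card (Fˣ × F) : ℂ) with hN
  have hN0 : N ≠ 0 := by simp [hN]
  rw [character_principalSeries]
  -- Only the Borel subgroup and its translate by the Weyl element contribute, with values `χ(t)`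
  -- and `χ(t⁻¹)`.
  have key : ∀ x : PGL(2, F), (∑ p : Fˣ × F,
      if borelElt p.1 p.2 = x * splitHom F t * x⁻¹ then N⁻¹ * (χ p.1 : ℂ) else 0) =
      (if ∃ a c, x = borelElt a c then N⁻¹ * (χ t : ℂ) else 0) +
        if ∃ a c, x * k₀ 1 = borelElt a c then N⁻¹ * (χ t⁻¹ : ℂ) else 0 := by
    intro x
    have hx := not_eq_borelElt_and x
    by_cases h1 : ∃ a c, x = borelElt a c
    · rw [if_pos h1, if_neg fun h2 => hx ⟨h1, h2⟩, add_zero]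
      obtain ⟨a, c, rfl⟩ := h1
      rw [borelElt_conj_splitHom]
      exact sum_ite_borelElt_eq (f := fun a => N⁻¹ * (χ a : ℂ)) _ _
    · by_cases h2 : ∃ a c, x * k₀ 1 = borelElt a c
      · rw [if_neg h1, if_pos h2, zero_add]
        obtain ⟨a, c, h2⟩ := h2
        rw [conj_splitHom_of_mul_k₀ h2]
        exact sum_ite_borelElt_eq (f := fun a => N⁻¹ * (χ a : ℂ)) _ _
      · rw [if_neg h1, if_neg h2, add_zero]
        refine Finset.sum_eq_zero fun p _ => if_neg fun h => ?_
        exact (eq_borelElt_or_of_conj_splitHom ht h.symm).elim h1 h2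
  have hshift : (∑ x : PGL(2, F), if ∃ a c, x * k₀ 1 = borelElt a c then N⁻¹ * (χ t⁻¹ : ℂ) else 0) =
      ∑ x : PGL(2, F), if ∃ a c, x = borelElt a c then N⁻¹ * (χ t⁻¹ : ℂ) else 0 :=
    Fintype.sum_equiv (Equiv.mulRight (k₀ 1)) _ _ fun x => if_congr Iff.rfl rfl rfl
  rw [Finset.sum_congr rfl fun x _ => key x, Finset.sum_add_distrib, sum_ite_borelElt_eq_one,
    hshift, sum_ite_borelElt_eq_one, ← hN, mul_inv_cancel_left₀ hN0,
    mul_inv_cancel_left₀ hN0]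

omit [Fintype E] in
theorem character_principalSeries_regularEmbedding (hα : ¬ IsSquare (α : F))
    (hb : IsSqrtBasis b α) (χ : Fˣ →* ℂˣ) {e : Eˣ} (he : regularEmbedding b e ≠ 1) :
    (principalSeries χ).character (regularEmbedding b e) = 0 := by
  rw [character_principalSeries]
  refine Finset.sum_eq_zero fun x _ => Finset.sum_eq_zero fun p _ => if_neg fun h => ?_
  exact conj_regularEmbedding_ne_borelElt hα hb he x _ _ h.symm

theorem sum_character_eq_zero {A : Type*} [Group A] [Fintype A] {c : A →* ℂˣ} (hc : c ≠ 1) :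
    ∑ a, (c a : ℂ) = 0 := by
  refine sum_hom_units_eq_zero ((Units.coeHom ℂ).comp c) fun h => hc ?_
  ext a
  exact DFunLike.congr_fun h a

theorem sum_character_inv_eq_zero {A : Type*} [Group A] [Fintype A] {c : A →* ℂˣ} (hc : c ≠ 1) :
    ∑ a, (c a⁻¹ : ℂ) = 0 := by
  rw [← sum_character_eq_zero hc]
  exact Fintype.sum_equiv (Equiv.inv A) _ _ fun _ => rfl

omit [Fintype F] [Fintype E] in
theorem exists_regularEmbedding_eq_k₀ (hb : IsSqrtBasis b α) :
    ∃ s : Eˣ, (s : E) = b 1 ∧ regularEmbedding b s = k₀ α :=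
  ⟨Units.mk0 (b 1) (b.ne_zero 1), rfl, regularEmbedding_sqrt hb _ rfl⟩

omit [Fintype F] in
theorem neg_one_ne_one_units (hF : ringChar F ≠ 2) : (-1 : Fˣ) ≠ 1 := by
  intro h
  exact Ring.neg_one_ne_one_of_char_ne_two hF (by simpa using congrArg Units.val h)

theorem principalSeries_sign {V : Type*} [AddCommGroup V] [Module ℂ V] [FiniteDimensional ℂ V]
    (hF : ringChar F ≠ 2) (hα : ¬ IsSquare (α : F)) (hb : IsSqrtBasis b α)
    (π : Representation ℂ PGL(2, F) V) {χ : Fˣ →* ℂˣ} (hχ : χ ≠ 1)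
    (h : π.character = (principalSeries χ).character) :
    MultiplicityOne α π ∧ HasCommonSign α π (χ (-1) : ℂ) := by
  -- At `1` this reads `q + 1 = 2 + (q - 1) = 0 + (q + 1)`.
  refine multiplicityOne_and_hasCommonSign hF hα hb π (f := fun t => (χ t : ℂ) + (χ t⁻¹ : ℂ))
    (g := 0) ?_ (by simp) ?_ ?_ ?_
  · rw [Finset.sum_add_distrib, sum_character_eq_zero hχ, sum_character_inv_eq_zero hχ, add_zero]
  · intro t
    rw [h, splitHom_eq_one_iff]
    split_ifs with ht
    · rw [ht, map_one, character_principalSeries_one]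
      simp
      ring
    · rw [character_principalSeries_splitHom χ ht, add_zero]
  · intro e
    rw [h, Pi.zero_apply, zero_add]
    split_ifs with he
    · rw [he, character_principalSeries_one]
    · exact character_principalSeries_regularEmbedding hα hb χ he
  · obtain ⟨s, -, hs⟩ := exists_regularEmbedding_eq_k₀ hb
    rw [h, ← hs, character_principalSeries_regularEmbedding hα hb χ (hs ▸ k₀_ne_one α),
      ← splitHom_neg_one, character_principalSeries_splitHom χ (neg_one_ne_one_units hF)]
    simp

/-- Substitute `P⁻¹x` for `x` in the sum. This lets the arbitrary basis in `IsCuspidalOf` be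
replaced by `1, √α`. -/
theorem character_coind_conj {G A : Type*} [Group G] [Fintype G] [Group A] [Fintype A]
    {φ φ' : A →* G} {P : G} (h : ∀ a, φ' a = P * φ a * P⁻¹) (ψ : A →* ℂˣ) :
    (Representation.coind φ' (charRep ψ)).character =
      (Representation.coind φ (charRep ψ)).character := by
  ext g
  rw [character_coind, character_coind]
  congr 1
  refine Fintype.sum_equiv (Equiv.mulLeft P⁻¹) _ _ fun x => Finset.sum_congr rfl fun a _ =>
    if_congr ?_ rfl rfl
  rw [h, Equiv.coe_mulLeft, mul_inv_rev, inv_inv, mul_inv_eq_iff_eq_mul, ← eq_inv_mul_iff_mul_eq]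
  simp only [mul_assoc]

theorem character_unipotent_eq_zero {θ : Multiplicative F →* ℂˣ} {g : PGL(2, F)}
    (hg : ∀ x c, x * g * x⁻¹ ≠ borelElt 1 c) :
    (Representation.coind (unipotent F) (charRep θ)).character g = 0 := by
  rw [character_coind]
  refine mul_eq_zero_of_right _ (Finset.sum_eq_zero fun x _ => Finset.sum_eq_zero fun a _ =>
    if_neg fun h => hg x a.toAdd ?_)
  rw [← h, unipotent, borelElt]
  refine mk_eq_mk_of_eq_smul one_ne_zero ?_
  rw [one_smul]
  rfl

omit [Fintype F] in
theorem unipotent_eq_one_iff {a : Multiplicative F} : unipotent F a = 1 ↔ a = 1 := by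
  refine ⟨fun h => ?_, fun h => by rw [h, map_one]⟩
  rw [← map_one (unipotent F)] at h
  obtain ⟨u, -, hu⟩ := exists_eq_smul_of_mk_eq_mk h
  change !![1, a.toAdd; 0, 1] = u • !![1, (1 : Multiplicative F).toAdd; 0, 1] at hu
  have := congrFun (congrFun hu 0) 1
  simpa using this

theorem character_unipotent_one (θ : Multiplicative F →* ℂˣ) :
    (Representation.coind (unipotent F) (charRep θ)).character 1 =
      (Fintype.card F - 1) * (Fintype.card F + 1) := by
  rw [character_coind]
  simp_rw [mul_one, mul_inv_cancel, unipotent_eq_one_iff]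
  rw [Finset.sum_congr rfl fun _ _ => Finset.sum_ite_eq' _ _ _, if_pos (Finset.mem_univ _)]
  rw [Finset.sum_const, Finset.card_univ, nsmul_eq_mul, card_PGL, Fintype.card_multiplicative]
  have := card_ne_zero' (F := F)
  simp only [map_one, Units.val_one, mul_one]
  field_simp

/-! ### Induction from the non-split torus -/

section Torus

variable {ψ : Eˣ →* ℂˣ}

/-- The fibres are cosets of the kernel, which has `q - 1` elements, and `ψ` is constant on them. -/
theorem sum_ite_regularEmbedding_eq (hb : IsSqrtBasis b α)
    (hψ : ∀ e, regularEmbedding b e = 1 → ψ e = 1) (e : Eˣ) :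
    ∑ e', (if regularEmbedding b e' = regularEmbedding b e then (ψ e' : ℂ) else 0) =
      (Fintype.card F - 1) * ψ e := by
  rw [← sum_ite_regularEmbedding_eq_one hb]
  refine (Fintype.sum_equiv (Equiv.mulLeft e) _ _ fun a => ?_).symm
  rw [Equiv.coe_mulLeft, map_mul]
  simp only [mul_eq_left]
  split_ifs with h
  · rw [map_mul, hψ a h, mul_one]
  · rfl

theorem sum_ite_mem_range_regularEmbedding (hb : IsSqrtBasis b α) (c : ℂ) :
    ∑ x : PGL(2, F), (if x ∈ (regularEmbedding b).range then (Fintype.card F - 1) * c else 0) =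
      Fintype.card Eˣ * c := by
  have : ∀ x : PGL(2, F),
      (if x ∈ (regularEmbedding b).range then (Fintype.card F - 1) * c else 0) =
      (∑ e, if regularEmbedding b e = x then (1 : ℂ) else 0) * c := by
    intro x
    split_ifs with h
    · obtain ⟨e, rfl⟩ := h
      have := sum_ite_regularEmbedding_eq (ψ := 1) hb (fun _ _ => rfl) e
      simp only [MonoidHom.one_apply, Units.val_one, mul_one] at this
      rw [this]
    · rw [Finset.sum_eq_zero, zero_mul]
      exact fun e _ => if_neg fun he => h ⟨e, he⟩
  rw [Finset.sum_congr rfl fun x _ => this x, ← Finset.sum_mul, Finset.sum_comm]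
  simp

theorem character_torus_one (hb : IsSqrtBasis b α)
    (hψ : ∀ e, regularEmbedding b e = 1 → ψ e = 1) :
    (Representation.coind (regularEmbedding b) (charRep ψ)).character 1 =
      Fintype.card F * (Fintype.card F - 1) := by
  rw [character_coind]
  simp_rw [mul_one, mul_inv_cancel, ← map_one (regularEmbedding b)]
  rw [Finset.sum_congr rfl fun _ _ => sum_ite_regularEmbedding_eq hb hψ 1, Finset.sum_const,
    Finset.card_univ, nsmul_eq_mul, card_PGL, card_units_cast, card_eq_sq b]
  have := card_sub_one_ne_zero (F := F)
  have := card_add_one_ne_zero (F := F)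
  have h2 : ((Fintype.card F ^ 2 : ℕ) : ℂ) - 1 =
      ((Fintype.card F : ℂ) - 1) * ((Fintype.card F : ℂ) + 1) := by push_cast; ring
  rw [h2]
  simp only [map_one, Units.val_one, mul_one]
  field_simp

theorem character_torus_splitHom (hα : ¬ IsSquare (α : F)) (hb : IsSqrtBasis b α) {t : Fˣ}
    (ht : t ≠ 1) :
    (Representation.coind (regularEmbedding b) (charRep ψ)).character (splitHom F t) = 0 := by
  rw [character_coind]
  refine mul_eq_zero_of_right _ (Finset.sum_eq_zero fun x _ => Finset.sum_eq_zero fun a _ =>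
    if_neg fun h => conj_splitHom_ne_regularEmbedding hα hb ht x a h.symm)

theorem character_torus_regularEmbedding (hF : ringChar F ≠ 2) (hb : IsSqrtBasis b α)
    (hψ : ∀ e, regularEmbedding b e = 1 → ψ e = 1) {e : Eˣ} (he : regularEmbedding b e ≠ 1) :
    (Representation.coind (regularEmbedding b) (charRep ψ)).character (regularEmbedding b e) =
      (ψ e : ℂ) + (ψ e⁻¹ : ℂ) := by
  have h2 : (2 : F) ≠ 0 := Ring.two_ne_zero hF
  rw [character_coind]
  -- Only the normalizer of the torus contributes: the torus itself gives `ψ(e)` and its translate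
  -- by `h₀` gives `ψ(e⁻¹)`.
  have key : ∀ x : PGL(2, F), (∑ e', if regularEmbedding b e' = x * regularEmbedding b e * x⁻¹ then
      (ψ e' : ℂ) else 0) =
      (if x ∈ (regularEmbedding b).range then (Fintype.card F - 1) * (ψ e : ℂ) else 0) +
        if x * h₀ ∈ (regularEmbedding b).range then (Fintype.card F - 1) * (ψ e⁻¹ : ℂ) else 0 := by
    intro x
    by_cases h1 : x ∈ (regularEmbedding b).range
    · have hx : x * h₀ ∉ (regularEmbedding b).range := fun h =>
        h₀_notMem_range h2 hb ((Subgroup.mul_mem_cancel_left _ h1).1 h)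
      rw [if_pos h1, if_neg hx, add_zero]
      obtain ⟨y, rfl⟩ := h1
      rw [← map_mul, mul_comm y, map_mul, mul_inv_cancel_right]
      exact sum_ite_regularEmbedding_eq hb hψ e
    · by_cases hx : x * h₀ ∈ (regularEmbedding b).range
      · rw [if_neg h1, if_pos hx, zero_add]
        obtain ⟨y, hy⟩ := hx
        have hx : x = regularEmbedding b y * h₀ := by
          rw [hy, mul_assoc, h₀_mul_self, mul_one]
        have : x * regularEmbedding b e * x⁻¹ = regularEmbedding b e⁻¹ := by
          rw [mul_inv_eq_iff_eq_mul, hx, mul_assoc, ← mul_assoc _ _ h₀, ← map_mul, mul_comm e⁻¹,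
            map_mul, mul_assoc, hb.h₀_mul_regularEmbedding_inv, inv_inv]
        rw [this]
        exact sum_ite_regularEmbedding_eq hb hψ e⁻¹
      · rw [if_neg h1, if_neg hx, add_zero]
        refine Finset.sum_eq_zero fun e' _ => if_neg fun h => ?_
        exact (mem_range_or_of_conj_regularEmbedding h2 hb he h).elim h1 hx
  have h0 : (Fintype.card Eˣ : ℂ) ≠ 0 := by simp
  have hshift : (∑ x : PGL(2, F), if x * h₀ ∈ (regularEmbedding b).range then ((Fintype.card F : ℂ) - 1) * (ψ e⁻¹ : ℂ) else 0) =
      ∑ x : PGL(2, F), if x ∈ (regularEmbedding b).range then ((Fintype.card F : ℂ) - 1) * (ψ e⁻¹ : ℂ) else 0 :=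
    Fintype.sum_equiv (Equiv.mulRight h₀) _ _ fun x => if_congr Iff.rfl rfl rfl
  rw [Finset.sum_congr rfl fun x _ => key x, Finset.sum_add_distrib,
    sum_ite_mem_range_regularEmbedding hb,
    hshift, sum_ite_mem_range_regularEmbedding hb, ← mul_add, inv_mul_cancel_left₀ h0]

end Torus

/-- The sign of a representation whose character is the cuspidal one. -/
theorem cuspidal_sign {V : Type*} [AddCommGroup V] [Module ℂ V] [FiniteDimensional ℂ V]
    (hF : ringChar F ≠ 2) (hα : ¬ IsSquare (α : F)) (hb : IsSqrtBasis b α)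
    (π : Representation ℂ PGL(2, F) V) {ψ : Eˣ →* ℂˣ} (hψ1 : ψ ≠ 1)
    (hψ : ∀ e, regularEmbedding b e = 1 → ψ e = 1) (h : IsCuspidalOf π ψ) {s : Eˣ}
    (hs : regularEmbedding b s = k₀ α) :
    MultiplicityOne α π ∧ HasCommonSign α π (-(ψ s : ℂ)) := by
  obtain ⟨b', θ, -, ⟨φ⟩⟩ := h
  obtain ⟨P, hP⟩ := exists_conj_regularEmbedding b b'
  have hch : ∀ g, π.character g =
      (Representation.coind (unipotent F) (charRep θ.toMonoidHom)).character g -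
        (Representation.coind (regularEmbedding b) (charRep ψ)).character g := by
    intro g
    rw [← character_coind_conj hP ψ, ← Representation.char_iso φ, character_prod, add_sub_cancel_right]
  have hone : π.character 1 = Fintype.card F - 1 := by
    rw [hch, character_unipotent_one, character_torus_one hb hψ]
    ring
  have hsplit : ∀ t : Fˣ, t ≠ 1 → π.character (splitHom F t) = 0 := fun t ht => by
    rw [hch, character_unipotent_eq_zero fun x c => conj_splitHom_ne_borelElt_one ht x c,
      character_torus_splitHom hα hb ht, sub_zero]
  have hreg : ∀ e, regularEmbedding b e ≠ 1 →
      π.character (regularEmbedding b e) = -((ψ e : ℂ) + (ψ e⁻¹ : ℂ)) := fun e he => by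
    rw [hch, character_unipotent_eq_zero fun x c =>
      conj_regularEmbedding_ne_borelElt hα hb he x 1 c,
      character_torus_regularEmbedding hF hb hψ he, zero_sub]
  -- At `1` this reads `q - 1 = 0 + (q - 1) = -2 + (q + 1)`.
  refine multiplicityOne_and_hasCommonSign hF hα hb π (f := 0)
    (g := fun e => -((ψ e : ℂ) + (ψ e⁻¹ : ℂ))) (by simp) ?_ ?_ ?_ ?_
  · rw [Finset.sum_neg_distrib, Finset.sum_add_distrib, sum_character_eq_zero hψ1,
      sum_character_inv_eq_zero hψ1, add_zero, neg_zero]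
  · intro t
    rw [splitHom_eq_one_iff, Pi.zero_apply, zero_add]
    split_ifs with ht
    · rw [ht, map_one, hone]
    · exact hsplit t ht
  · intro e
    split_ifs with he
    · rw [he, hone, hψ e he, hψ e⁻¹ (by rw [map_inv, he, inv_one])]
      simp
      ring
    · rw [hreg e he, add_zero]
  · have hss : ψ s⁻¹ = ψ s := by
      have : ψ (s * s) = 1 := hψ _ (by rw [map_mul, hs, k₀_mul_self])
      rw [map_inv, inv_eq_iff_mul_eq_one, ← map_mul, this]
    rw [← splitHom_neg_one, hsplit _ (neg_one_ne_one_units hF), ← hs, hreg s (hs ▸ k₀_ne_one α), hss]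
    ring

end Characters

/-! ### The twisted Steinberg representation -/

section Steinberg

open scoped Classical

variable {F E : Type*} [Field F] [Fintype F] [Field E] [Fintype E] [Algebra F E] {α : Fˣ}
  {b : Module.Basis (Fin 2) F E}

instance : Fintype (ℙ F (Fin 2 → F)) := Fintype.ofFinite _

theorem card_projectiveLine : Fintype.card (ℙ F (Fin 2 → F)) = Fintype.card F + 1 := by
  rw [← Nat.card_eq_fintype_card, ← Nat.card_eq_fintype_card,
    Projectivization.card_of_finrank_two F (Fin 2 → F) (by simp)]

theorem character_steinberg (g : PGL(2, F)) : (steinberg F).character g =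
    (Finset.univ.filter fun x : ℙ F (Fin 2 → F) => g • x = x).card - 1 := by
  set N : ℂ := (Fintype.card (ℙ F (Fin 2 → F)) : ℂ) with hN
  have hN0 : N ≠ 0 := by
    rw [hN, card_projectiveLine]
    push_cast
    exact card_add_one_ne_zero
  -- Subtracting the mean retracts all functions onto those of sum zero; the mean accounts for the
  -- `-1` in the character.
  let p : (ℙ F (Fin 2 → F) → ℂ) →ₗ[ℂ] steinbergSpace F :=
    { toFun := fun f => ⟨fun x => f x - N⁻¹ * ∑ y, f y, by
        change ∑ᶠ x, _ = (0 : ℂ)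
        rw [finsum_eq_sum_of_fintype, Finset.sum_sub_distrib, Finset.sum_const, Finset.card_univ,
          nsmul_eq_mul, ← hN, mul_inv_cancel_left₀ hN0, sub_self]⟩
      map_add' := fun f g => Subtype.ext <| funext fun x => by
        simp only [Pi.add_apply, Finset.sum_add_distrib, Submodule.coe_add]
        ring
      map_smul' := fun r f => Subtype.ext <| funext fun x => by
        simp only [Pi.smul_apply, smul_eq_mul, ← Finset.mul_sum, Submodule.coe_smul,
          RingHom.id_apply]
        ring }
  have hp : p ∘ₗ (steinbergSpace F).subtype = LinearMap.id := by
    ext f x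
    have hf : ∑ᶠ x, (f : ℙ F (Fin 2 → F) → ℂ) x = 0 := f.2
    rw [finsum_eq_sum_of_fintype] at hf
    change (f : ℙ F (Fin 2 → F) → ℂ) x - N⁻¹ * ∑ y, (f : ℙ F (Fin 2 → F) → ℂ) y = f.1 x
    rw [hf, mul_zero, sub_zero]
  have h1 : steinberg F g = (steinberg F g ∘ₗ p) ∘ₗ (steinbergSpace F).subtype := by
    rw [LinearMap.comp_assoc, hp, LinearMap.comp_id]
  rw [Representation.character, h1, LinearMap.trace_comp_comm', LinearMap.trace_eq_matrix_trace ℂ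
    (Pi.basisFun ℂ (ℙ F (Fin 2 → F))), Matrix.trace]
  have key : ∀ x : ℙ F (Fin 2 → F), Matrix.diag (LinearMap.toMatrix (Pi.basisFun ℂ _)
      (Pi.basisFun ℂ _) ((steinbergSpace F).subtype ∘ₗ steinberg F g ∘ₗ p)) x =
      (if g • x = x then 1 else 0) - N⁻¹ := by
    intro x
    rw [Matrix.diag_apply, LinearMap.toMatrix_apply, Pi.basisFun_apply, Pi.basisFun_repr]
    change (Pi.single x 1 : ℙ F (Fin 2 → F) → ℂ) (g⁻¹ • x) -
      N⁻¹ * ∑ y, (Pi.single x 1 : ℙ F (Fin 2 → F) → ℂ) y = _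
    rw [Finset.sum_pi_single' x (1 : ℂ), if_pos (Finset.mem_univ _), mul_one, Pi.single_apply]
    congr 1
    exact if_congr (inv_smul_eq_iff.trans eq_comm) rfl rfl
  rw [Finset.sum_congr rfl fun x _ => key x, Finset.sum_sub_distrib, Finset.sum_const,
    Finset.card_univ, nsmul_eq_mul, ← hN, mul_inv_cancel₀ hN0, Finset.sum_boole]

theorem character_twistedSteinberg (χ : Fˣ →* ℂˣ) (hχ : χ ^ 2 = 1) (g : PGL(2, F)) :
    Representation.character (V := TensorProduct ℂ (steinbergSpace F) ℂ) (twistedSteinberg χ hχ) g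
      = (steinberg F).character g * (detChar χ hχ g : ℂ) := by
  rw [twistedSteinberg, Representation.char_tensor, Pi.mul_apply, character_charRep]

omit [Fintype F] in
theorem projectiveLine_mk_eq_mk_iff {v w : Fin 2 → F} (hv : v ≠ 0) (hw : w ≠ 0) :
    Projectivization.mk F v hv = Projectivization.mk F w hw ↔ v 0 * w 1 = v 1 * w 0 := by
  rw [Projectivization.mk_eq_mk_iff']
  constructor
  · rintro ⟨c, rfl⟩
    simp
    ring
  · intro h
    by_cases h0 : w 0 = 0
    · have h1 : w 1 ≠ 0 := fun h1 => hw (by ext i; fin_cases i <;> simp [h0, h1])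
      refine ⟨v 1 / w 1, ?_⟩
      have : v 0 = 0 := by simpa [h0, h1] using h
      ext i
      fin_cases i
      · simp [h0, this]
      · simp [h1]
    · refine ⟨v 0 / w 0, ?_⟩
      ext i
      fin_cases i
      · simp [h0]
      · simp
        field_simp
        linear_combination h

omit [Fintype F] in
theorem smul_mk_eq_iff (X : GL (Fin 2) F) {v : Fin 2 → F} (hv : v ≠ 0) :
    Matrix.ProjGenLinGroup.mk X • Projectivization.mk F v hv = Projectivization.mk F v hv ↔
      (X.1 0 0 * v 0 + X.1 0 1 * v 1) * v 1 = (X.1 1 0 * v 0 + X.1 1 1 * v 1) * v 0 := by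
  rw [Projectivization.PGL.mk_smul_mk, projectiveLine_mk_eq_mk_iff]
  have : X • v = X.1.mulVec v := rfl
  rw [this]
  simp [Matrix.mulVec, dotProduct, Fin.sum_univ_two]

theorem character_steinberg_one : (steinberg F).character 1 = Fintype.card F := by
  rw [character_steinberg]
  simp [card_projectiveLine]

theorem character_steinberg_splitHom {t : Fˣ} (ht : t ≠ 1) :
    (steinberg F).character (splitHom F t) = 1 := by
  have hv : (![1, 0] : Fin 2 → F) ≠ 0 := fun h => one_ne_zero (congrFun h 0)
  have hw : (![0, 1] : Fin 2 → F) ≠ 0 := fun h => one_ne_zero (congrFun h 1)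
  have : (Finset.univ.filter fun x : ℙ F (Fin 2 → F) => splitHom F t • x = x) =
      {Projectivization.mk F _ hv, Projectivization.mk F _ hw} := by
    ext x
    induction x using Projectivization.ind with | h v hv' =>
    rw [Finset.mem_filter, Finset.mem_insert, Finset.mem_singleton, projectiveLine_mk_eq_mk_iff,
      projectiveLine_mk_eq_mk_iff, splitHom_apply, borelElt, smul_mk_eq_iff]
    change _ ∧ ((t : F) * v 0 + 0 * v 1) * v 1 = (0 * v 0 + 1 * v 1) * v 0 ↔ _
    have ht' : (t : F) - 1 ≠ 0 := fun h => ht (Units.ext (sub_eq_zero.1 h))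
    simp only [Finset.mem_univ, true_and, Matrix.cons_val_zero, Matrix.cons_val_one, mul_zero,
      mul_one]
    constructor
    · intro h
      have : ((t : F) - 1) * (v 0 * v 1) = 0 := by linear_combination h
      rcases mul_eq_zero.1 ((mul_eq_zero.1 this).resolve_left ht') with h | h
      · exact Or.inr h
      · exact Or.inl h.symm
    · rintro (h | h)
      · rw [← h]; ring
      · rw [h]; ring
  rw [character_steinberg, this, Finset.card_pair]
  · norm_num
  · rw [Ne, projectiveLine_mk_eq_mk_iff]
    simp

omit [Fintype E] in
theorem character_steinberg_regularEmbedding (hα : ¬ IsSquare (α : F))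
    (hb : IsSqrtBasis b α) {e : Eˣ} (he : regularEmbedding b e ≠ 1) :
    (steinberg F).character (regularEmbedding b e) = -1 := by
  have : (Finset.univ.filter fun x : ℙ F (Fin 2 → F) => regularEmbedding b e • x = x) = ∅ := by
    refine Finset.filter_eq_empty_iff.2 fun {x} _ => ?_
    induction x using Projectivization.ind with | h v hv =>
    rw [regularEmbedding_apply, smul_mk_eq_iff]
    change ¬ ((Algebra.leftMulMatrix b (e : E) 0 0 * _ + Algebra.leftMulMatrix b (e : E) 0 1 * _) *
      _ = (Algebra.leftMulMatrix b (e : E) 1 0 * _ + Algebra.leftMulMatrix b (e : E) 1 1 * _) * _)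
    rw [hb.leftMulMatrix_eq]
    rw [Ne, hb.regularEmbedding_eq_one_iff] at he
    simp only [Matrix.of_apply, Matrix.cons_val', Matrix.cons_val_zero, Matrix.cons_val_one]
    intro h
    -- The diagonal terms of the fixed-point equation cancel, leaving this relation times the
    -- nonzero second coordinate of `e`.
    have h2 : v 0 ^ 2 = α * v 1 ^ 2 := by
      apply mul_left_cancel₀ he
      linear_combination -h
    by_cases h1 : v 1 = 0
    · refine hv ?_
      have h0 : v 0 = 0 := by simpa [h1] using h2
      ext i
      fin_cases i <;> simp [h0, h1]
    · refine hα ⟨v 0 / v 1, ?_⟩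
      field_simp
      linear_combination -h2
  rw [character_steinberg, this]
  simp

omit [Fintype F] in
theorem detChar_splitHom (χ : Fˣ →* ℂˣ) (hχ : χ ^ 2 = 1) (t : Fˣ) :
    detChar χ hχ (splitHom F t) = χ t := by
  change χ (Matrix.GeneralLinearGroup.det _) = χ t
  congr 1
  ext
  change Matrix.det !![_, _; _, _] = _
  simp

omit [Fintype F] [Fintype E] in
theorem detChar_regularEmbedding (χ : Fˣ →* ℂˣ) (hχ : χ ^ 2 = 1) (e : Eˣ) :
    detChar χ hχ (regularEmbedding b e) = χ (Units.map (Algebra.norm F) e) := by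
  change χ (Matrix.GeneralLinearGroup.det _) = _
  congr 1
  ext
  change Matrix.det (Algebra.leftMulMatrix b (e : E)) = Algebra.norm F (e : E)
  rw [Algebra.norm_eq_matrix_det b]

/-- `χ` is trivial on squares and every non-square is `α` times a square, so `χ(α) = 1` would make
`χ` trivial. -/
theorem eq_neg_one_of_not_isSquare {χ : Fˣ →* ℂˣ} (hχ : χ ^ 2 = 1) (hχ1 : χ ≠ 1)
    (hα : ¬ IsSquare (α : F)) : (χ α : ℂ) = -1 := by
  have hsq : ∀ t, (χ t : ℂ) ^ 2 = 1 := fun t => by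
    have := congrArg (fun c : Fˣ →* ℂˣ => ((c t : ℂˣ) : ℂ)) hχ
    simpa using this
  refine (mul_self_eq_one_iff.1 (by rw [← sq, hsq])).resolve_left fun h => hχ1 ?_
  ext t
  rw [MonoidHom.one_apply, Units.val_one]
  by_cases ht : IsSquare (t : F)
  · obtain ⟨r, hr⟩ := ht
    have hr0 : r ≠ 0 := by rintro rfl; simp at hr
    have : t = Units.mk0 r hr0 ^ 2 := by ext; simp [hr, sq]
    rw [this, map_pow, Units.val_pow_eq_pow_val, hsq]
  · obtain ⟨r, hr0, hr⟩ := exists_eq_mul_sq hα ht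
    have : t = α * Units.mk0 r hr0 ^ 2 := by ext; simp [hr]
    rw [this, map_mul, map_pow, Units.val_mul, Units.val_pow_eq_pow_val, hsq, h, mul_one]

theorem twistedSteinberg_sign {V : Type*} [AddCommGroup V] [Module ℂ V] [FiniteDimensional ℂ V]
    (hF : ringChar F ≠ 2) (hα : ¬ IsSquare (α : F)) (hb : IsSqrtBasis b α)
    (π : Representation ℂ PGL(2, F) V) {χ : Fˣ →* ℂˣ} (hχ : χ ^ 2 = 1) (hχ1 : χ ≠ 1)
    (h : π.character =
      Representation.character (V := TensorProduct ℂ (steinbergSpace F) ℂ) (twistedSteinberg χ hχ)) :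
    MultiplicityOne α π ∧ HasCommonSign α π (χ (-1) : ℂ) := by
  have hreg : ∀ e, regularEmbedding b e ≠ 1 → π.character (regularEmbedding b e) =
      -(χ (Units.map (Algebra.norm F) e) : ℂ) := fun e he => by
    rw [h, character_twistedSteinberg, detChar_regularEmbedding,
      character_steinberg_regularEmbedding hα hb he, neg_one_mul]
  have hsplit : ∀ t : Fˣ, t ≠ 1 → π.character (splitHom F t) = χ t := fun t ht => by
    rw [h, character_twistedSteinberg, detChar_splitHom, character_steinberg_splitHom ht, one_mul]
  -- At `1` this reads `q = 1 + (q - 1) = -1 + (q + 1)`.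
  refine multiplicityOne_and_hasCommonSign hF hα hb π (f := fun t => (χ t : ℂ))
    (g := fun e => -(χ (Units.map (Algebra.norm F) e) : ℂ)) (sum_character_eq_zero hχ1) ?_ ?_ ?_ ?_
  · have : ∑ e : Eˣ, (χ (Units.map (Algebra.norm F) e) : ℂ) = 0 :=
      sum_character_eq_zero (comp_norm_ne_one (E := E) hχ1)
    rw [Finset.sum_neg_distrib, this, neg_zero]
  · intro t
    rw [splitHom_eq_one_iff]
    split_ifs with ht
    · rw [h, ht, map_one, character_twistedSteinberg, character_steinberg_one, map_one]
      simp
    · rw [hsplit t ht, add_zero]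
  · intro e
    split_ifs with he
    · have h1 := detChar_regularEmbedding (b := b) χ hχ e
      rw [he, map_one] at h1
      rw [h, character_twistedSteinberg, he, map_one, character_steinberg_one, ← h1]
      simp
    · rw [hreg e he, add_zero]
  · obtain ⟨s, hs1, hs⟩ := exists_regularEmbedding_eq_k₀ hb
    -- Since `N(√α) = -α` and `χ(α) = -1`, the character at `k₀` is `-χ(-α) = χ(-1)`, the same as at
    -- `h₀`.
    have hN : Units.map (Algebra.norm F : E →* F) s = -1 * α := by
      ext
      have h0 := hb.repr_zero 0 1
      have h1 := hb.repr_one 0 1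
      simp only [map_zero, map_one, zero_add, one_mul] at h0 h1
      rw [Units.coe_map]
      change Algebra.norm F (s : E) = _
      rw [hb.norm_eq, hs1]
      simp
    rw [← hs, hreg s (hs ▸ k₀_ne_one α), ← splitHom_neg_one,
      hsplit _ (neg_one_ne_one_units hF), hN, map_mul, Units.val_mul,
      eq_neg_one_of_not_isSquare hχ hχ1 hα]
    ring

omit [Fintype E] in
omit [Fintype F] in
-- If `(m + n√α)² = δ` then `2mn = 0`, and `n = 0` would make `δ` a square. So `s = n√α`, and all
-- choices of `δ` and of its root agree modulo `Fˣ`.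
theorem regularEmbedding_eq_k₀_of_sq (h2 : (2 : F) ≠ 0) (hb : IsSqrtBasis b α) {δ : F}
    (hδ : ¬ IsSquare δ) {s : Eˣ} (hs : (s : E) ^ 2 = algebraMap F E δ) :
    regularEmbedding b s = k₀ α := by
  obtain ⟨m, hm⟩ : ∃ m, m = b.repr (s : E) 0 := ⟨_, rfl⟩
  obtain ⟨n, hn⟩ : ∃ n, n = b.repr (s : E) 1 := ⟨_, rfl⟩
  have hs' := hb.eq_add (s : E)
  rw [← hm, ← hn] at hs'
  have hsq : algebraMap F E (m ^ 2 + α * n ^ 2) + algebraMap F E (2 * m * n) * b 1 =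
      algebraMap F E δ + algebraMap F E 0 * b 1 := by
    rw [← hs, hs']
    simp only [map_add, map_mul, map_pow, map_zero, map_ofNat]
    linear_combination -(algebraMap F E n) ^ 2 * hb.one_sq
  have h0 := congrArg (fun z => b.repr z 0) hsq
  have h1 := congrArg (fun z => b.repr z 1) hsq
  simp only [hb.repr_zero, hb.repr_one] at h0 h1
  have hn0 : n ≠ 0 := by
    rintro rfl
    exact hδ ⟨m, by rw [← h0]; ring⟩
  have hm0 : m = 0 := by simpa [h2, hn0] using h1
  rw [regularEmbedding_apply, k₀]
  refine mk_eq_mk_of_eq_smul hn0 ?_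
  change Algebra.leftMulMatrix b (s : E) = n • !![_, _; _, _]
  rw [hb.leftMulMatrix_eq, ← hm, ← hn, hm0]
  ext i j
  fin_cases i <;> fin_cases j <;> simp [mul_comm]

/-- An element of `Fˣ` is a norm `y^(q+1)`, and `ψ^(q+1) = 1`. -/
theorem eq_one_of_regularEmbedding_eq_one (hb : IsSqrtBasis b α) {ψ : Eˣ →* ℂˣ}
    (hψ : ψ ^ Fintype.card F = ψ⁻¹) {e : Eˣ} (he : regularEmbedding b e = 1) : ψ e = 1 := by
  rw [hb.regularEmbedding_eq_one_iff] at he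
  have he' := hb.eq_add (e : E)
  rw [he, RingHom.map_zero, zero_mul, add_zero] at he'
  obtain ⟨y, hy⟩ := FiniteField.norm_surjective F E (b.repr (e : E) 0)
  have hq : (Nat.card E - 1) / (Nat.card F - 1) = Fintype.card F + 1 := by
    have h1 : 1 < Fintype.card F := Fintype.one_lt_card
    rw [Nat.card_eq_fintype_card, Nat.card_eq_fintype_card, card_eq_sq b]
    refine Nat.div_eq_of_eq_mul_left (by omega) ?_
    rw [← Nat.sq_sub_sq _ 1, one_pow]
  have hye : y ^ (Fintype.card F + 1) = e := by
    rw [he', ← hy, FiniteField.algebraMap_norm_eq_pow, hq]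
  have hy0 : y ≠ 0 := by
    rintro rfl
    exact e.ne_zero (by rw [← hye, zero_pow (Nat.succ_ne_zero _)])
  have : e = Units.mk0 y hy0 ^ (Fintype.card F + 1) := by ext; simp [hye]
  rw [this, map_pow, pow_succ]
  have := DFunLike.congr_fun hψ (Units.mk0 y hy0)
  rw [MonoidHom.pow_apply, MonoidHom.inv_apply] at this
  rw [this, inv_mul_cancel]

end Steinberg

end PGL2Sign

end

/-! ### The two signs and their values -/

theorem proposition3p2 {F E V : Type*} [Field F] [Fintype F] (hF : ringChar F ≠ 2)
    [Field E] [Algebra F E] (hE : Module.finrank F E = 2)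
    [AddCommGroup V] [Module ℂ V]
    (α : Fˣ) (hα : ¬ IsSquare (α : F))
    (π : Representation ℂ PGL(2, F) V) (hπ : π.IsIrreducible) :
    -- the two signs coincide
    (PGL2Sign.MultiplicityOne α π →
      ∃ ε : ℂ, (ε = 1 ∨ ε = -1) ∧ PGL2Sign.HasCommonSign α π ε) ∧
    -- principal series
    (∀ χ : Fˣ →* ℂˣ, χ ^ 2 ≠ 1 → Nonempty (π.Equiv (PGL2Sign.principalSeries χ)) →
      PGL2Sign.MultiplicityOne α π ∧ PGL2Sign.HasCommonSign α π (χ (-1) : ℂ)) ∧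
    -- twisted Steinberg
    (∀ (χ : Fˣ →* ℂˣ) (hχ : χ ^ 2 = 1), χ ≠ 1 →
      Nonempty (π.Equiv (PGL2Sign.twistedSteinberg χ hχ)) →
      PGL2Sign.MultiplicityOne α π ∧ PGL2Sign.HasCommonSign α π (χ (-1) : ℂ)) ∧
    -- cuspidal representations
    (∀ ψ : Eˣ →* ℂˣ, ψ ≠ ψ ^ Fintype.card F → ψ ^ Fintype.card F = ψ⁻¹ →
      PGL2Sign.IsCuspidalOf π ψ →
      ∀ (δ : F) (s : Eˣ), ¬ IsSquare δ → (s : E) ^ 2 = algebraMap F E δ →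
      PGL2Sign.MultiplicityOne α π ∧ PGL2Sign.HasCommonSign α π (-(ψ s : ℂ))) := by

  have : FiniteDimensional F E := .of_finrank_pos (by omega)
  have : Finite E := Module.finite_of_finite F
  have := Fintype.ofFinite E
  have := PGL2Sign.finiteDimensional_of_isIrreducible π hπ
  obtain ⟨b, hb⟩ := PGL2Sign.exists_isSqrtBasis hF hE hα
  refine ⟨fun h => ?_, fun χ hχ ⟨φ⟩ => ?_, fun χ hχ hχ1 ⟨φ⟩ => ?_, fun ψ hψ1 hψ h δ s hδ hs => ?_⟩
  · have hε := PGL2Sign.hasCommonSign_of_multiplicityOne hF hα hb π h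
    exact ⟨_, PGL2Sign.sign_eq_one_or_neg_one h hε, hε⟩
  · refine PGL2Sign.principalSeries_sign hF hα hb π (fun h => hχ ?_) (Representation.char_iso φ)
    rw [h]
    ext
    simp
  · exact PGL2Sign.twistedSteinberg_sign hF hα hb π hχ hχ1 (Representation.char_iso φ)
  · refine PGL2Sign.cuspidal_sign hF hα hb π (fun h => hψ1 ?_)
      (fun e => PGL2Sign.eq_one_of_regularEmbedding_eq_one hb hψ) h
      (PGL2Sign.regularEmbedding_eq_k₀_of_sq (Ring.two_ne_zero hF) hb hδ hs)
    rw [h]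
    ext
    simp
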